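/- Let $A$ be an AW*-algebra, i.e. a C*-algebra in which the right annihilator of any subset is the right ideal $pA$ generated by a single projection $p$. For projections $e,f\in A$ write $e\le f$ if $e=ef$; write $e\sim f$ if $e=vv^*$ and $f=v^*v$ for some $v\in A$; and write $e\precsim f$ if $e\sim e'\le f$ for some projection $e'$. Write $C(e)$ for the central cover of $e$, the least central projection $z$ with $e\le z$. A projection $e$ is *finite* if $e\sim f\le e$ implies $e=f$ for every projection $f$, and *infinite* otherwise. A nonzero projection $e$ is *properly infinite* if for every central projection $z$ the projection $ze$ is either zero or infinite. For a properly infinite projection $e$, let $d(e)$ be the least cardinal strictly greater than $\operatorname{card} I$ for every orthogonal family $(e_i)_{i\in I}$ of projections whose supremum in the lattice of projections is $e$ and such that $e_i\sim e$ for all $i\in I$. A properly infinite projection $e$ is *equidimensional* if $d(ze)=d(e)$ for every nonzero central projection $z\le C(e)$. **Corollary 5.4.** Let $e$ and $f$ be properly infinite, equidimensional projections in an AW*-algebra. Then $$e\precsim f \iff C(e)\le C(f)\ \text{ and }\ d(e)\le d(f).$$ Therefore $$e\sim f \iff C(e)=C(f)\ \text{ and }\ d(e)=d(f).$$ -/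

import Mathlib

/-- An AW*-algebra: a C*-algebra in which the right annihilator of every subset is the right
ideal generated by a single projection.  (Applied to the empty subset this forces a unit, so
nothing is lost by starting from Mathlib's unital C*-algebras.) -/
class AWStarAlgebra (A : Type*) [CStarAlgebra A] : Prop where
  exists_rightAnnihilator (S : Set A) :
    ∃ p : A, IsStarProjection p ∧ {x : A | ∀ s ∈ S, s * x = 0} = {x : A | ∃ a : A, x = p * a}

namespace AWStar

universe u

section Basic

variable {A : Type u} [CStarAlgebra A]

/-- The order on projections: `e ≤ f` iff `e = e f`. -/
def ProjLE (e f : A) : Prop := e = e * f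

/-- Equivalence of projections: `e = v v*` and `f = v* v` for some `v`. -/
def Equivalent (e f : A) : Prop := ∃ v : A, e = v * star v ∧ f = star v * v

/-- Subequivalence: `e` is equivalent to some projection `e' ≤ f`. -/
def Subequivalent (e f : A) : Prop :=
  ∃ e' : A, IsStarProjection e' ∧ Equivalent e e' ∧ ProjLE e' f

/-- A projection lying in the centre of the algebra. -/
def IsCentralProjection (z : A) : Prop := IsStarProjection z ∧ ∀ a : A, z * a = a * z

/-- `z` is the least central projection above `e`. -/
def IsCentralCover (e z : A) : Prop :=
  IsCentralProjection z ∧ ProjLE e z ∧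
    ∀ w : A, IsCentralProjection w → ProjLE e w → ProjLE z w

/-- A projection `e` is finite when `e ∼ f ≤ e` implies `e = f`. -/
def IsFinite (e : A) : Prop :=
  IsStarProjection e ∧ ∀ f : A, IsStarProjection f → Equivalent e f → ProjLE f e → e = f

/-- A projection is infinite when it is not finite. -/
def IsInfinite (e : A) : Prop := IsStarProjection e ∧ ¬ IsFinite e

/-- A projection `e` is properly infinite when it is nonzero and, for every central projection
`z`, the projection `z e` is either zero or infinite. -/
def IsProperlyInfinite (e : A) : Prop :=
  IsStarProjection e ∧ e ≠ 0 ∧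
    ∀ z : A, IsCentralProjection z → z * e = 0 ∨ IsInfinite (z * e)

/-- `e = ∑ p i`: the `p i` are pairwise orthogonal projections, and `e` is their least upper
bound among the projections. -/
def IsOrthogonalSum {I : Type u} (p : I → A) (e : A) : Prop :=
  (∀ i, IsStarProjection (p i)) ∧ (∀ i j, i ≠ j → p i * p j = 0) ∧
    IsStarProjection e ∧ (∀ i, ProjLE (p i) e) ∧
    ∀ q : A, IsStarProjection q → (∀ i, ProjLE (p i) q) → ProjLE e q

/-- The set `Γ(e)`, as a predicate on families: `p` is an orthogonal family of projections
with sum `e`, all of them equivalent to `e`. -/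
def InGamma (e : A) {I : Type u} (p : I → A) : Prop :=
  IsOrthogonalSum p e ∧ ∀ i, Equivalent (p i) e

open Classical in
/-- The dimension `d(e)`: the least cardinal strictly greater than the cardinality of the index
set of every family in `Γ(e)`; by convention `d(0) = 0`.  For `e ≠ 0` the members of a family
in `Γ(e)` are distinct, so index sets in the universe of `A` are enough and the set of cardinals
below is nonempty. -/
noncomputable def dim (e : A) : Cardinal.{u} :=
  if e = 0 then 0
  else sInf {κ : Cardinal.{u} | ∀ (I : Type u) (p : I → A), InGamma e p → Cardinal.mk I < κ}

end Basic

section Cover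

variable {A : Type u} [CStarAlgebra A] [AWStarAlgebra A]

theorem exists_isCentralCover (e : A) : ∃ z : A, IsCentralCover e z := by
  obtain ⟨p, hp, hS⟩ := AWStarAlgebra.exists_rightAnnihilator {x : A | ∃ a : A, x = e * a}
  have mem : ∀ x : A, (∀ a : A, e * a * x = 0) ↔ ∃ a : A, x = p * a := by
    intro x
    have h := Set.ext_iff.mp hS x
    constructor
    · intro hx
      refine h.mp ?_
      rintro s ⟨a, rfl⟩
      exact hx a
    · intro hx a
      exact h.mpr hx _ ⟨a, rfl⟩
  have hpp : p * p = p := hp.isIdempotentElem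
  have hps : star p = p := hp.isSelfAdjoint
  have hp0 : ∀ a : A, e * a * p = 0 := (mem p).mpr ⟨p, hpp.symm⟩
  have key : ∀ b : A, p * b * p = b * p := by
    intro b
    obtain ⟨c, hc⟩ := (mem (b * p)).mp (fun a => by
      rw [← mul_assoc, mul_assoc e a b]; exact hp0 _)
    rw [mul_assoc, hc, ← mul_assoc, hpp]
  have hcomm : ∀ b : A, p * b = b * p := by
    intro b
    have h := congrArg star (key (star b))
    simp only [star_mul, star_star, hps] at h
    rw [← h, ← mul_assoc, key b]
  refine ⟨1 - p, ⟨hp.one_sub, fun a => ?_⟩, ?_, fun w hw hew => ?_⟩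
  · rw [sub_mul, mul_sub, one_mul, mul_one, hcomm]
  · have h := hp0 1
    rw [mul_one] at h
    unfold ProjLE
    rw [mul_sub, mul_one, h, sub_zero]
  · obtain ⟨c, hc⟩ := (mem (1 - w)).mp (fun a => by
      rw [mul_assoc, mul_sub, mul_one, ← hw.2 a, mul_sub, ← mul_assoc, ← hew, sub_self])
    have h : p * (1 - w) = 1 - w := by rw [hc, ← mul_assoc, hpp]
    have h2 : (1 - p) * (1 - w) = 0 := by rw [sub_mul, one_mul, h, sub_self]
    rw [mul_sub, mul_one] at h2
    exact sub_eq_zero.mp h2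

/-- The central cover `C(e)`: the least central projection above `e`. -/
noncomputable def centralCover (e : A) : A := Classical.choose (exists_isCentralCover e)

theorem centralCover_spec (e : A) : IsCentralCover e (centralCover e) :=
  Classical.choose_spec (exists_isCentralCover e)

/-- A properly infinite projection `e` is equidimensional if `d(z e) = d(e)` for every nonzero
central projection `z ≤ C(e)`; by convention `0` is equidimensional as well. -/
def IsEquidimensional (e : A) : Prop :=
  e = 0 ∨ (IsProperlyInfinite e ∧
    ∀ z : A, IsCentralProjection z → z ≠ 0 → ProjLE z (centralCover e) → dim (z * e) = dim e)

end Cover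

end AWStar

namespace AWStar

universe u

/-! ### Order and orthogonality of projections. -/

section Projections

variable {A : Type u} [CStarAlgebra A]

/-! Projections of an AW*-algebra have suprema, but there is no weak topology in which infinitely
many partial isometries could be added. Everything therefore goes through annihilators: the supremum
of a family is the projection with the same right annihilator. Three tools are built on this:
additivity of equivalence over orthogonal families with orthogonal suprema (`famSup_equivalent`),
generalized comparability (`exists_comparison`) and Schröder–Bernstein (`Subequivalent.antisymm`).

The engine is `exists_central_decomposition`. Suppose that `e` contains infinitely many orthogonal
copies of `q ≠ 0`, and enlarge them to a maximal such family. The remainder contains no copy of `q`,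
so over some central `z` with `z q ≠ 0` it is subequivalent to `z q` and is absorbed by the
infinitely many copies. Thus `z e` is equivalent to a sum of copies of `z q`; regrouping along `J ×
J × 2 ≃ J` makes it a sum of equally many copies of itself. This bounds `d(z e)` from below, and
equidimensionality replaces `d(z e)` by `d(e)`.

If `e ≾ f`, then large families in `Γ(e)` embed in `f`, and the engine gives `d(e) ≤ d(f)`. For the
converse, comparability leaves only central parts on which `f ≾ e`. There, on a smaller central
part, `e` is equivalent to a sum of `J` copies of `f` with `#J < d(e) ≤ d(f)`, so `f` splits into at
least `#J` copies of itself and has room for `e`. A maximal orthogonal family of central projections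
glues these local comparisons (`subequivalent_of_central_cover`). The criterion for equivalence
follows by Schröder–Bernstein. -/

theorem mul_mul_of_mul_eq {a b c : A} (h : a * b = c) (x : A) : a * (b * x) = c * x := by
  rw [← mul_assoc, h]

theorem ProjLE.mul_eq {e f : A} (h : ProjLE e f) : e * f = e := h.symm

theorem ProjLE.mul_eq_left {e f : A} (h : ProjLE e f) (he : IsStarProjection e)
    (hf : IsStarProjection f) : f * e = e := by
  have := congrArg star h.mul_eq
  rwa [star_mul, he.isSelfAdjoint.star_eq, hf.isSelfAdjoint.star_eq] at this

theorem projLE_of_mul_eq_left {e f : A} (he : IsStarProjection e) (hf : IsStarProjection f)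
    (h : f * e = e) : ProjLE e f := by
  have := congrArg star h
  rw [star_mul, he.isSelfAdjoint.star_eq, hf.isSelfAdjoint.star_eq] at this
  exact this.symm

theorem ProjLE.refl {e : A} (he : IsStarProjection e) : ProjLE e e := he.isIdempotentElem.symm

theorem ProjLE.trans {e f g : A} (h : ProjLE e f) (h' : ProjLE f g) : ProjLE e g := by
  unfold ProjLE
  rw [← h.mul_eq, mul_assoc, h'.mul_eq]

theorem ProjLE.antisymm {e f : A} (he : IsStarProjection e) (hf : IsStarProjection f)
    (h : ProjLE e f) (h' : ProjLE f e) : e = f :=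
  Eq.trans h (h'.mul_eq_left hf he)

theorem mul_eq_zero_symm {e f : A} (he : IsStarProjection e) (hf : IsStarProjection f)
    (h : e * f = 0) : f * e = 0 := by
  have := congrArg star h
  rwa [star_mul, he.isSelfAdjoint.star_eq, hf.isSelfAdjoint.star_eq, star_zero] at this

/-- Testing on `1 - f` turns the order into inclusion of right annihilators, the form in which
suprema are accessible. -/
theorem projLE_of_mul_eq_zero {e f : A} (h : ∀ x, f * x = 0 → e * x = 0)
    (hf : IsStarProjection f) : ProjLE e f := by
  have := h (1 - f) hf.mul_one_sub_self
  rw [mul_sub, mul_one] at this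
  exact sub_eq_zero.mp this

theorem ProjLE.mul_eq_zero {e f : A} (h : ProjLE e f) {x : A} (hx : f * x = 0) : e * x = 0 := by
  rw [← h.mul_eq, mul_assoc, hx, mul_zero]

theorem eq_of_mul_eq_zero_iff {e f : A} (he : IsStarProjection e) (hf : IsStarProjection f)
    (h : ∀ x, e * x = 0 ↔ f * x = 0) : e = f :=
  ProjLE.antisymm he hf (projLE_of_mul_eq_zero (fun x => (h x).mpr) hf)
    (projLE_of_mul_eq_zero (fun x => (h x).mp) he)

theorem ProjLE.sub {e f : A} (h : ProjLE e f) (he : IsStarProjection e)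
    (hf : IsStarProjection f) : IsStarProjection (f - e) :=
  he.sub_of_mul_eq_left hf h.mul_eq

theorem projLE_sub {e f : A} (h : ProjLE e f)
    (hf : IsStarProjection f) : ProjLE (f - e) f := by
  unfold ProjLE
  rw [sub_mul, hf.isIdempotentElem.eq, h.mul_eq]

theorem mul_sub_eq_zero {e f : A} (h : ProjLE e f) (he : IsStarProjection e) :
    e * (f - e) = 0 := by
  rw [mul_sub, h.mul_eq, he.isIdempotentElem.eq, sub_self]

theorem projLE_add {e f g : A} (he : ProjLE e g) (hf : ProjLE f g) : ProjLE (e + f) g := by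
  unfold ProjLE
  rw [add_mul, he.mul_eq, hf.mul_eq]

theorem projLE_add_left {e f : A} (he : IsStarProjection e) (h : e * f = 0) :
    ProjLE e (e + f) := by
  unfold ProjLE
  rw [mul_add, he.isIdempotentElem.eq, h, add_zero]

theorem projLE_add_right {e f : A} (hf : IsStarProjection f) (h : f * e = 0) :
    ProjLE f (e + f) := by
  unfold ProjLE
  rw [mul_add, hf.isIdempotentElem.eq, h, zero_add]

/-- `v` is a partial isometry with final projection `e` and initial projection `f`. -/
structure Implements (v e f : A) : Prop where
  mul_star_eq : v * star v = e
  star_mul_eq : star v * v = f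
  left_mul : e * v = v
  mul_right : v * f = v

/-! ### Calculus of partial isometries. -/

namespace Implements

variable {v w e f g : A}

/-- The C*-identity kills `v * (1 - f)`, so one of the defining equations already forces the others.
-/
theorem of_right (hf : IsStarProjection f) (h : star v * v = f) : Implements v (v * star v) f := by
  have hv : v * f = v := by
    have : star (v * (1 - f)) * (v * (1 - f)) = 0 := by
      rw [star_mul, mul_assoc, mul_mul_of_mul_eq h, hf.mul_one_sub_self, mul_zero]
    rw [CStarRing.star_mul_self_eq_zero_iff, mul_sub, mul_one, sub_eq_zero] at this
    exact this.symm
  exact ⟨rfl, h, by rw [mul_assoc, h, hv], hv⟩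

theorem symm (h : Implements v e f) : Implements (star v) f e where
  mul_star_eq := by rw [star_star, h.star_mul_eq]
  star_mul_eq := by rw [star_star, h.mul_star_eq]
  left_mul := by
    have := congrArg star h.mul_right
    rwa [star_mul, ← h.star_mul_eq, star_mul, star_star, h.star_mul_eq] at this
  mul_right := by
    have := congrArg star h.left_mul
    rwa [star_mul, ← h.mul_star_eq, star_mul, star_star, h.mul_star_eq] at this

theorem isStarProjection_left (h : Implements v e f) : IsStarProjection e where
  isIdempotentElem := by
    show e * e = e
    nth_rw 2 [← h.mul_star_eq]
    rw [← mul_assoc, h.left_mul, h.mul_star_eq]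
  isSelfAdjoint := by rw [← h.mul_star_eq]; exact .mul_star_self v

theorem isStarProjection_right (h : Implements v e f) : IsStarProjection f :=
  h.symm.isStarProjection_left

theorem equivalent (h : Implements v e f) : Equivalent e f := ⟨v, h.mul_star_eq.symm, h.star_mul_eq.symm⟩

theorem trans (h : Implements v e f) (h' : Implements w f g) : Implements (v * w) e g where
  mul_star_eq := by
    rw [star_mul, mul_assoc, mul_mul_of_mul_eq h'.mul_star_eq, h.symm.left_mul, h.mul_star_eq]
  star_mul_eq := by
    rw [star_mul, mul_assoc, mul_mul_of_mul_eq h.star_mul_eq, h'.left_mul, h'.star_mul_eq]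
  left_mul := by rw [← mul_assoc, h.left_mul]
  mul_right := by rw [mul_assoc, h'.mul_right]

/-- Restriction of a partial isometry to a subprojection of its final projection. -/
theorem restrict (h : Implements v e f) {p : A} (hp : IsStarProjection p) (hpe : ProjLE p e) :
    Implements (p * v) p (star v * p * v) where
  mul_star_eq := by
    rw [star_mul, hp.isSelfAdjoint.star_eq, mul_assoc, mul_mul_of_mul_eq h.mul_star_eq,
      mul_mul_of_mul_eq hpe.mul_eq, hp.isIdempotentElem.eq]
  star_mul_eq := by
    rw [star_mul, hp.isSelfAdjoint.star_eq, mul_assoc, mul_assoc,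
      mul_mul_of_mul_eq hp.isIdempotentElem.eq]
  left_mul := by rw [mul_mul_of_mul_eq hp.isIdempotentElem.eq]
  mul_right := by
    rw [mul_assoc, mul_assoc, mul_mul_of_mul_eq h.mul_star_eq, mul_mul_of_mul_eq hpe.mul_eq,
      mul_mul_of_mul_eq hp.isIdempotentElem.eq]

theorem restrict_le (h : Implements v e f) (p : A) : ProjLE (star v * p * v) f := by
  unfold ProjLE
  rw [mul_assoc _ v f, h.mul_right]

theorem add {v' e' f' : A} (h : Implements v e f) (h' : Implements v' e' f')
    (he : e * e' = 0) (hf : f * f' = 0) : Implements (v + v') (e + e') (f + f') := by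
  have he' := mul_eq_zero_symm h.isStarProjection_left h'.isStarProjection_left he
  have hf' := mul_eq_zero_symm h.isStarProjection_right h'.isStarProjection_right hf
  have h1 : v * star v' = 0 := by
    rw [← h.mul_right, ← h'.symm.left_mul, mul_assoc, mul_mul_of_mul_eq hf, zero_mul, mul_zero]
  have h2 : star v * v' = 0 := by
    rw [← h.symm.mul_right, ← h'.left_mul, mul_assoc, mul_mul_of_mul_eq he, zero_mul, mul_zero]
  have h3 : v' * star v = 0 := by
    rw [← h'.mul_right, ← h.symm.left_mul, mul_assoc, mul_mul_of_mul_eq hf', zero_mul, mul_zero]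
  have h4 : star v' * v = 0 := by
    rw [← h'.symm.mul_right, ← h.left_mul, mul_assoc, mul_mul_of_mul_eq he', zero_mul, mul_zero]
  have h5 : e * v' = 0 := by rw [← h'.left_mul, mul_mul_of_mul_eq he, zero_mul]
  have h6 : e' * v = 0 := by rw [← h.left_mul, mul_mul_of_mul_eq he', zero_mul]
  have h7 : v * f' = 0 := by rw [← h.mul_right, mul_assoc, hf, mul_zero]
  have h8 : v' * f = 0 := by rw [← h'.mul_right, mul_assoc, hf', mul_zero]
  constructor
  · rw [star_add, add_mul, mul_add, mul_add, h1, h3, h.mul_star_eq, h'.mul_star_eq, add_zero, zero_add]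
  · rw [star_add, add_mul, mul_add, mul_add, h2, h4, h.star_mul_eq, h'.star_mul_eq, add_zero, zero_add]
  · rw [add_mul, mul_add, mul_add, h5, h6, h.left_mul, h'.left_mul, add_zero, zero_add]
  · rw [add_mul, mul_add, mul_add, h7, h8, h.mul_right, h'.mul_right, add_zero, zero_add]

theorem central_mul {z : A} (h : Implements v e f) (hz : IsCentralProjection z) :
    Implements (z * v) (z * e) (z * f) where
  mul_star_eq := by
    rw [star_mul, hz.1.isSelfAdjoint.star_eq, ← hz.2, mul_assoc, ← mul_assoc v, ← hz.2 v,
      mul_assoc, h.mul_star_eq, mul_mul_of_mul_eq hz.1.isIdempotentElem.eq]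
  star_mul_eq := by
    rw [star_mul, hz.1.isSelfAdjoint.star_eq, mul_assoc,
      mul_mul_of_mul_eq hz.1.isIdempotentElem.eq, ← mul_assoc, ← hz.2, mul_assoc, h.star_mul_eq]
  left_mul := by
    rw [mul_assoc, ← mul_assoc e, ← hz.2 e, mul_assoc, h.left_mul,
      mul_mul_of_mul_eq hz.1.isIdempotentElem.eq]
  mul_right := by
    rw [mul_assoc, ← mul_assoc v, ← hz.2 v, mul_assoc, h.mul_right,
      mul_mul_of_mul_eq hz.1.isIdempotentElem.eq]

end Implements

/-! ### Equivalence and subequivalence. -/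

theorem Equivalent.exists_implements {e f : A} (hf : IsStarProjection f) (h : Equivalent e f) :
    ∃ v, Implements v e f := by
  obtain ⟨v, rfl, h⟩ := h
  exact ⟨v, .of_right hf h.symm⟩

theorem Equivalent.symm {e f : A} (h : Equivalent e f) : Equivalent f e := by
  obtain ⟨v, h, h'⟩ := h
  exact ⟨star v, by rwa [star_star], by rwa [star_star]⟩

theorem Equivalent.refl {e : A} (he : IsStarProjection e) : Equivalent e e :=
  ⟨e, by rw [he.isSelfAdjoint.star_eq, he.isIdempotentElem.eq],
    by rw [he.isSelfAdjoint.star_eq, he.isIdempotentElem.eq]⟩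

theorem Equivalent.trans {e f g : A} (hf : IsStarProjection f) (h : Equivalent e f)
    (h' : Equivalent f g) : Equivalent e g := by
  obtain ⟨v, hv⟩ := h.exists_implements hf
  obtain ⟨w, hw⟩ := h'.symm.exists_implements hf
  exact (hv.trans hw.symm).equivalent

theorem Equivalent.add {e f e' f' : A} (hf : IsStarProjection f) (hf' : IsStarProjection f')
    (h : Equivalent e f) (h' : Equivalent e' f') (he : e * e' = 0) (hff : f * f' = 0) :
    Equivalent (e + e') (f + f') := by
  obtain ⟨v, hv⟩ := h.exists_implements hf
  obtain ⟨w, hw⟩ := h'.exists_implements hf'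
  exact (hv.add hw he hff).equivalent

theorem Equivalent.central_mul {e f z : A} (hf : IsStarProjection f) (h : Equivalent e f)
    (hz : IsCentralProjection z) : Equivalent (z * e) (z * f) := by
  obtain ⟨v, hv⟩ := h.exists_implements hf
  exact (hv.central_mul hz).equivalent

theorem Equivalent.eq_zero {e f : A} (h : Equivalent e f) (hf : f = 0) : e = 0 := by
  obtain ⟨v, rfl, h⟩ := h
  rw [hf, eq_comm, CStarRing.star_mul_self_eq_zero_iff] at h
  rw [h, zero_mul]

theorem Equivalent.subequivalent {e f : A} (hf : IsStarProjection f) (h : Equivalent e f) :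
    Subequivalent e f := ⟨f, hf, h, .refl hf⟩

theorem ProjLE.subequivalent {e f : A} (he : IsStarProjection e) (h : ProjLE e f) :
    Subequivalent e f := ⟨e, he, .refl he, h⟩

theorem Subequivalent.eq_zero {e f : A} (h : Subequivalent e f) (hf : f = 0) : e = 0 := by
  obtain ⟨e', -, h, h'⟩ := h
  exact h.eq_zero (by rw [← h'.mul_eq, hf, mul_zero])

theorem Subequivalent.trans {e f g : A} (h : Subequivalent e f)
    (h' : Subequivalent f g) : Subequivalent e g := by
  obtain ⟨e', he', hee, hle⟩ := h
  obtain ⟨f', hf', hff, hle'⟩ := h'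
  obtain ⟨w, hw⟩ := hff.exists_implements hf'
  have := hw.restrict he' hle
  exact ⟨_, this.isStarProjection_right, hee.trans he' this.equivalent,
    (hw.restrict_le e').trans hle'⟩

theorem Subequivalent.central_mul {e f z : A} (h : Subequivalent e f)
    (hz : IsCentralProjection z) : Subequivalent (z * e) (z * f) := by
  obtain ⟨e', he', hee, hle⟩ := h
  refine ⟨z * e', hz.1.mul he' (hz.2 e'), hee.central_mul he' hz, ?_⟩
  unfold ProjLE
  rw [mul_assoc, ← mul_assoc e', ← hz.2 e', mul_assoc, hle.mul_eq,
    mul_mul_of_mul_eq hz.1.isIdempotentElem.eq]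

theorem Subequivalent.add {e f e' f' : A} (hf : IsStarProjection f) (hf' : IsStarProjection f')
    (h : Subequivalent e f) (h' : Subequivalent e' f') (he : e * e' = 0) (hff : f * f' = 0) :
    Subequivalent (e + e') (f + f') := by
  obtain ⟨p, hp, hep, hle⟩ := h
  obtain ⟨p', hp', hep', hle'⟩ := h'
  have hpp : p * p' = 0 := by
    rw [← hle.mul_eq, ← hle'.mul_eq_left hp' hf', mul_assoc, mul_mul_of_mul_eq hff, zero_mul,
      mul_zero]
  exact ⟨p + p', hp.add hp' hpp, hep.add hp hp' hep' he hpp,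
    projLE_add (hle.trans (projLE_add_left hf hff))
      (hle'.trans (projLE_add_right hf' (mul_eq_zero_symm hf hf' hff)))⟩

/-! ### Central projections. -/

theorem IsCentralProjection.one_sub {z : A} (hz : IsCentralProjection z) :
    IsCentralProjection (1 - z) :=
  ⟨hz.1.one_sub, fun a => by rw [sub_mul, mul_sub, hz.2, one_mul, mul_one]⟩

theorem IsCentralProjection.mul {z w : A} (hz : IsCentralProjection z)
    (hw : IsCentralProjection w) : IsCentralProjection (z * w) :=
  ⟨hz.1.mul hw.1 (hz.2 w), fun a => by rw [mul_assoc, hw.2, ← mul_assoc, hz.2, mul_assoc]⟩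

theorem IsCentralProjection.mul_isStarProjection {z e : A} (hz : IsCentralProjection z)
    (he : IsStarProjection e) : IsStarProjection (z * e) := hz.1.mul he (hz.2 e)

theorem mul_projLE {e : A} (z : A) (he : IsStarProjection e) : ProjLE (z * e) e := by
  unfold ProjLE
  rw [mul_assoc, he.isIdempotentElem.eq]

theorem IsCentralProjection.mul_projLE_mul {z e f : A} (hz : IsCentralProjection z)
    (h : ProjLE e f) : ProjLE (z * e) (z * f) := by
  unfold ProjLE
  rw [mul_assoc, ← mul_assoc e, ← hz.2 e, mul_assoc, h.mul_eq,
    mul_mul_of_mul_eq hz.1.isIdempotentElem.eq]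

theorem IsCentralProjection.mul_mul_mul {z : A} (hz : IsCentralProjection z) (a b : A) :
    z * a * (z * b) = z * (a * b) := by
  rw [mul_assoc, ← mul_assoc a, ← hz.2 a, mul_assoc, mul_mul_of_mul_eq hz.1.isIdempotentElem.eq]

/-- By hypothesis the right annihilator of `p` is also a left ideal, whence `p a (1 - p) = 0` for
all `a`. The adjoint of this relation for `star a` gives `(1 - p) a p = 0`. -/
theorem isCentralProjection_of_annihilator {p : A} (hp : IsStarProjection p)
    (h : ∀ x a, p * x = 0 → p * (a * x) = 0) : IsCentralProjection p := by
  have key : ∀ a : A, p * a * p = p * a := fun a => by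
    have := h (1 - p) a hp.mul_one_sub_self
    rw [mul_sub, mul_one, mul_sub, sub_eq_zero] at this
    rw [mul_assoc, ← this]
  refine ⟨hp, fun a => ?_⟩
  have := congrArg star (key (star a))
  simp only [star_mul, star_star, hp.isSelfAdjoint.star_eq] at this
  rw [← key, mul_assoc, this]

/-- A pairwise orthogonal family of projections. -/
def IsOrthFamily {I : Type*} (p : I → A) : Prop :=
  (∀ i, IsStarProjection (p i)) ∧ ∀ i j, i ≠ j → p i * p j = 0

theorem IsOrthFamily.comp {I J : Type*} {p : I → A} (hp : IsOrthFamily p) {a : J → I}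
    (ha : Function.Injective a) : IsOrthFamily (p ∘ a) :=
  ⟨fun _ => hp.1 _, fun _ _ h => hp.2 _ _ (ha.ne h)⟩

theorem IsOrthogonalSum.isOrthFamily {I : Type u} {p : I → A} {e : A}
    (h : IsOrthogonalSum p e) : IsOrthFamily p := ⟨h.1, h.2.1⟩

end Projections

/-! ### Suprema of projections via annihilators. -/

section Supremum

variable {A : Type u} [CStarAlgebra A] [AWStarAlgebra A]

theorem exists_supProj (S : Set A) :
    ∃ p : A, IsStarProjection p ∧ ∀ x, p * x = 0 ↔ ∀ s ∈ S, s * x = 0 := by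
  obtain ⟨q, hq, hS⟩ := AWStarAlgebra.exists_rightAnnihilator S
  refine ⟨1 - q, hq.one_sub, fun x => ?_⟩
  rw [show (∀ s ∈ S, s * x = 0) ↔ ∃ a, x = q * a from Set.ext_iff.mp hS x]
  constructor
  · intro h
    rw [sub_mul, one_mul, sub_eq_zero] at h
    exact ⟨x, h⟩
  · rintro ⟨a, rfl⟩
    rw [← mul_assoc, hq.one_sub_mul_self, zero_mul]

/-- The projection whose right annihilator is that of `S`; for a set of projections, its
supremum. -/
noncomputable def supProj (S : Set A) : A := (exists_supProj S).choose

theorem isStarProjection_supProj (S : Set A) : IsStarProjection (supProj S) :=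
  (exists_supProj S).choose_spec.1

theorem supProj_mul_eq_zero {S : Set A} {x : A} : supProj S * x = 0 ↔ ∀ s ∈ S, s * x = 0 :=
  (exists_supProj S).choose_spec.2 x

/-- The supremum of a family of projections. -/
noncomputable def famSup {I : Type*} (p : I → A) : A := supProj (Set.range p)

variable {I : Type*} {p : I → A}

theorem isStarProjection_famSup : IsStarProjection (famSup p) := isStarProjection_supProj _

theorem famSup_mul_eq_zero {x : A} : famSup p * x = 0 ↔ ∀ i, p i * x = 0 := by
  rw [famSup, supProj_mul_eq_zero, Set.forall_mem_range]

theorem projLE_famSup (i : I) : ProjLE (p i) (famSup p) :=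
  projLE_of_mul_eq_zero (fun _ hx => famSup_mul_eq_zero.mp hx i) isStarProjection_famSup

theorem famSup_projLE {e : A} (he : IsStarProjection e) (h : ∀ i, ProjLE (p i) e) :
    ProjLE (famSup p) e :=
  projLE_of_mul_eq_zero (fun _ hx => famSup_mul_eq_zero.mpr fun i => (h i).mul_eq_zero hx) he

theorem famSup_eq {e : A} (he : IsStarProjection e) (h : ∀ x, e * x = 0 ↔ ∀ i, p i * x = 0) :
    famSup p = e :=
  eq_of_mul_eq_zero_iff isStarProjection_famSup he fun x => by rw [famSup_mul_eq_zero, h]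

theorem IsOrthFamily.isOrthogonalSum {I : Type u} {p : I → A} (hp : IsOrthFamily p) :
    IsOrthogonalSum p (famSup p) :=
  ⟨hp.1, hp.2, isStarProjection_famSup, projLE_famSup, fun _ => famSup_projLE⟩

theorem IsOrthogonalSum.famSup_eq {I : Type u} {p : I → A} {e : A}
    (h : IsOrthogonalSum p e) : famSup p = e :=
  ProjLE.antisymm isStarProjection_famSup h.2.2.1 (famSup_projLE h.2.2.1 h.2.2.2.1)
    (h.2.2.2.2 _ isStarProjection_famSup projLE_famSup)

theorem famSup_mul_famSup {J : Type*} {q : J → A} (hp : ∀ i, IsStarProjection (p i))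
    (hq : ∀ j, IsStarProjection (q j)) (h : ∀ i j, p i * q j = 0) :
    famSup p * famSup q = 0 := by
  rw [famSup_mul_eq_zero]
  exact fun i => mul_eq_zero_symm isStarProjection_famSup (hp i)
    (famSup_mul_eq_zero.mpr fun j => mul_eq_zero_symm (hp i) (hq j) (h i j))

theorem IsCentralProjection.famSup_mul {z : A} (hz : IsCentralProjection z) :
    famSup (fun i => z * p i) = z * famSup p :=
  famSup_eq (hz.mul_isStarProjection isStarProjection_famSup) fun x => by
    rw [hz.2, mul_assoc, famSup_mul_eq_zero]
    exact forall_congr' fun i => by rw [← mul_assoc, ← hz.2]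

/-- A partial isometry carries the supremum of a family to the supremum of the images. -/
theorem Implements.famSup_conj {v e f : A} (h : Implements v e f) (hp : IsOrthFamily p)
    (hpe : famSup p = e) :
    IsOrthFamily (fun i => star v * p i * v) ∧ famSup (fun i => star v * p i * v) = f ∧
      ∀ i, Equivalent (p i) (star v * p i * v) := by
  have hle : ∀ i, ProjLE (p i) e := fun i => hpe ▸ projLE_famSup i
  refine ⟨⟨fun i => (h.restrict (hp.1 i) (hle i)).isStarProjection_right, fun i j hij => ?_⟩,
    famSup_eq h.isStarProjection_right fun x => ?_,
    fun i => (h.restrict (hp.1 i) (hle i)).equivalent⟩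
  · simp only [mul_assoc]
    rw [mul_mul_of_mul_eq h.mul_star_eq, mul_mul_of_mul_eq (hle i).mul_eq,
      mul_mul_of_mul_eq (hp.2 i j hij), zero_mul, mul_zero]
  · have h1 : f * x = 0 ↔ e * (v * x) = 0 := by
      rw [mul_mul_of_mul_eq h.left_mul]
      constructor
      · intro hx
        rw [← h.mul_right, mul_assoc, hx, mul_zero]
      · intro hx
        rw [← h.star_mul_eq, mul_assoc, hx, mul_zero]
    rw [h1, ← hpe, famSup_mul_eq_zero]
    refine forall_congr' fun i => ?_
    constructor
    · intro hx
      rw [mul_assoc, mul_assoc, hx, mul_zero]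
    · intro hx
      have := congrArg (v * ·) hx
      simp only [mul_assoc, mul_zero] at this
      rwa [mul_mul_of_mul_eq h.mul_star_eq, mul_mul_of_mul_eq ((hle i).mul_eq_left (hp.1 i)
        h.isStarProjection_left)] at this

/-- The right annihilator of the right ideal `e A` is two-sided, so the projection with that
annihilator is central; it dominates `e` and kills `f`. -/
theorem exists_central_of_mul_mul_eq_zero {e f : A} (h : ∀ a, e * a * f = 0) :
    ∃ z : A, IsCentralProjection z ∧ e * (1 - z) = 0 ∧ z * f = 0 := by
  refine ⟨supProj {x | ∃ a, x = e * a}, isCentralProjection_of_annihilator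
    (isStarProjection_supProj _) fun x a => ?_, ?_, ?_⟩
  · rw [supProj_mul_eq_zero, supProj_mul_eq_zero]
    rintro hx _ ⟨b, rfl⟩
    have := hx (e * (b * a)) ⟨_, rfl⟩
    simpa only [mul_assoc] using this
  · have := supProj_mul_eq_zero.mp
      (isStarProjection_supProj {x | ∃ a, x = e * a}).mul_one_sub_self (e * 1) ⟨1, rfl⟩
    rwa [mul_one] at this
  · rw [supProj_mul_eq_zero]
    rintro _ ⟨a, rfl⟩
    exact h a

theorem isCentralProjection_supProj {S : Set A} (hS : ∀ s ∈ S, IsCentralProjection s) :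
    IsCentralProjection (supProj S) :=
  isCentralProjection_of_annihilator (isStarProjection_supProj _) fun x a hx => by
    rw [supProj_mul_eq_zero] at hx ⊢
    intro s hs
    rw [← mul_assoc, (hS s hs).2, mul_assoc, hx s hs, mul_zero]

end Supremum

/-! ### Functional calculus and additivity of equivalence. -/

section Comparison

variable {A : Type u} [CStarAlgebra A]

/-- The projection onto the graph of a partial isometry between orthogonal projections. -/
theorem Implements.isStarProjection_graph {v e f : A} (h : Implements v e f) (hef : e * f = 0) :
    IsStarProjection ((1 / 2 : ℝ) • (e + f + v + star v)) := by
  have he := h.isStarProjection_left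
  have hf := h.isStarProjection_right
  have hfe := mul_eq_zero_symm he hf hef
  have hvv : v * v = 0 := by
    nth_rw 1 [← h.mul_right]
    rw [← h.left_mul, mul_assoc, mul_mul_of_mul_eq hfe, zero_mul, mul_zero]
  have hvv' : star v * star v = 0 := by rw [← star_mul, hvv, star_zero]
  have hfv : f * v = 0 := by rw [← h.left_mul, mul_mul_of_mul_eq hfe, zero_mul]
  have hve : v * e = 0 := by rw [← h.mul_right, mul_assoc, hfe, mul_zero]
  have hev : e * star v = 0 := by rw [← h.symm.left_mul, mul_mul_of_mul_eq hef, zero_mul]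
  have hvf : star v * f = 0 := by rw [← h.symm.mul_right, mul_assoc, hef, mul_zero]
  refine ⟨?_, ?_⟩
  · have : (e + f + v + star v) * (e + f + v + star v) = (2 : ℝ) • (e + f + v + star v) := by
      simp only [mul_add, add_mul, hvv, hvv', hfv, hve, hev, hvf, hef, hfe, h.left_mul,
        h.mul_right, h.symm.left_mul, h.symm.mul_right, h.mul_star_eq, h.star_mul_eq,
        he.isIdempotentElem.eq, hf.isIdempotentElem.eq, two_smul]
      abel
    rw [IsIdempotentElem, smul_mul_smul_comm, this, smul_smul]
    norm_num
  · rw [IsSelfAdjoint, star_smul, star_add, star_add, star_add, star_star,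
      he.isSelfAdjoint.star_eq, hf.isSelfAdjoint.star_eq, star_trivial, add_right_comm _ (star v)]

theorem add_mul_one_sub (e r : A) : e * r + e * (1 - r) = e := by
  rw [← mul_add, add_sub_cancel, mul_one]

theorem mul_one_sub_projLE {e r : A} (he : IsStarProjection e) (hre : r * e = e * r) :
    ProjLE (e * (1 - r)) e := by
  unfold ProjLE
  rw [mul_assoc, sub_mul, one_mul, hre, ← mul_one_sub, ← mul_assoc, he.isIdempotentElem.eq]

theorem mul_mul_one_sub_eq_zero {e r : A} (hr : IsStarProjection r) (hre : r * e = e * r) :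
    e * r * (e * (1 - r)) = 0 := by
  rw [mul_assoc, ← mul_assoc r, hre, mul_assoc, hr.mul_one_sub_self, mul_zero, mul_zero]

theorem add_mul_eq_zero_iff {e f x : A} (he : IsStarProjection e) (h : e * f = 0) :
    (e + f) * x = 0 ↔ e * x = 0 ∧ f * x = 0 := by
  constructor
  · intro hx
    have h1 := (projLE_add_left he h).mul_eq_zero hx
    exact ⟨h1, by rwa [add_mul, h1, zero_add] at hx⟩
  · rintro ⟨h1, h2⟩
    rw [add_mul, h1, h2, add_zero]

variable [AWStarAlgebra A]

theorem supProj_singleton_mul_eq_zero {x y : A} : supProj {x} * y = 0 ↔ x * y = 0 := by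
  rw [supProj_mul_eq_zero]
  simp

theorem mul_supProj_singleton (x : A) : x * supProj {x} = x := by
  have := supProj_singleton_mul_eq_zero.mp (isStarProjection_supProj {x}).mul_one_sub_self
  rw [mul_sub, mul_one, sub_eq_zero] at this
  exact this.symm

/-- A nonzero corner `e A f` yields nonzero equivalent subprojections of `e` and `f`. -/
theorem exists_equivalent_of_mul_mul_ne_zero {e f a : A} (he : IsStarProjection e)
    (hf : IsStarProjection f) (h : e * a * f ≠ 0) :
    ∃ p q : A, IsStarProjection p ∧ IsStarProjection q ∧ ProjLE p e ∧ ProjLE q f ∧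
      Equivalent p q ∧ q ≠ 0 := by
  set x := e * a * f with hx
  set b := star x * x with hb
  have hbsa : IsSelfAdjoint b := .star_mul_self x
  have hb0 : b ≠ 0 := by rwa [hb, Ne, CStarRing.star_mul_self_eq_zero_iff]
  obtain ⟨t, ht, ht0⟩ : ∃ t ∈ spectrum ℝ b, 0 < t := by
    by_contra! hcon
    apply hb0
    rw [← cfc_id ℝ b, ← cfc_zero ℝ b]
    exact cfc_congr fun t ht => le_antisymm (hcon t ht) (spectrum_star_mul_self_nonneg t ht)
  obtain ⟨ε, hε, hεt⟩ : ∃ ε, 0 < ε ∧ ε < t := exists_between ht0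
  have hmax : ∀ s : ℝ, 0 < max s ε := fun s => lt_max_of_lt_right hε
  have hc1 : Continuous fun s : ℝ => (√(max s ε))⁻¹ :=
    (by fun_prop : Continuous fun s : ℝ => √(max s ε)).inv₀ fun s => (Real.sqrt_pos.mpr (hmax s)).ne'
  have hc2 : Continuous fun s : ℝ => max (s - ε) 0 / max s ε :=
    Continuous.div (by fun_prop) (by fun_prop) fun s => (hmax s).ne'
  -- The spectrum is cut at `ε`: `c = (b - ε)₊`, `k = (ε - b)₊`, and `y = max(b, ε)^(-1/2)` is a
  -- bounded inverse square root of `b` above `ε`. Then `y b y` differs from `1` by a multiple of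
  -- `k`, which vanishes on the support `p` of `c`, so `x y p` is a partial isometry. The
  -- factorization `c = m b` puts `p` under `f`.
  set c := cfc (fun s : ℝ => max (s - ε) 0) b with hc
  set k := cfc (fun s : ℝ => max (ε - s) 0) b with hk
  set y := cfc (fun s : ℝ => (√(max s ε))⁻¹) b with hy
  set m := cfc (fun s : ℝ => max (s - ε) 0 / max s ε) b with hm
  have hck : c * k = 0 := by
    rw [hc, hk, ← cfc_mul .., ← cfc_zero ℝ b]
    refine cfc_congr fun s _ => ?_
    rcases le_total s ε with h | h
    · simp [max_eq_right (sub_nonpos.mpr h)]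
    · simp [max_eq_right (sub_nonpos.mpr h)]
  have hmb : c = m * b := by
    conv_rhs => rw [← cfc_id ℝ b]
    rw [hc, hm, ← cfc_mul _ _ b hc2.continuousOn]
    refine cfc_congr fun s _ => ?_
    rcases le_total s ε with h | h
    · simp [max_eq_right (sub_nonpos.mpr h)]
    · simp only [max_eq_left h, id]
      rw [div_mul_cancel₀ _ (hε.trans_le h).ne']
  have hyby : y * b * y = 1 - ε⁻¹ • k := by
    nth_rw 1 [← cfc_id ℝ b]
    rw [hy, hk, ← cfc_mul _ _ b hc1.continuousOn, ← cfc_mul _ _ b _ hc1.continuousOn,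
      ← cfc_smul .., ← cfc_one ℝ b, ← cfc_sub ..]
    · refine cfc_congr fun s _ => ?_
      have h1 : (√(max s ε))⁻¹ * s * (√(max s ε))⁻¹ = s / max s ε := by
        rw [mul_right_comm, ← mul_inv, Real.mul_self_sqrt (hmax s).le, div_eq_inv_mul]
      simp only [id, h1, Pi.one_apply, smul_eq_mul]
      rcases le_total s ε with h | h
      · rw [max_eq_right h, max_eq_left (sub_nonneg.mpr h)]
        field_simp
        ring
      · rw [max_eq_left h, max_eq_right (sub_nonpos.mpr h), mul_zero, sub_zero,
          div_self (hε.trans_le h).ne']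
    · exact hc1.continuousOn.mul continuousOn_id
  have hysa : star y = y := (IsSelfAdjoint.cfc (f := fun s : ℝ => (√(max s ε))⁻¹)).star_eq
  have hksa : star k = k := (IsSelfAdjoint.cfc (f := fun s : ℝ => max (ε - s) 0)).star_eq
  have hp := isStarProjection_supProj {c}
  set p := supProj {c}
  have hkp : k * p = 0 := by
    have := congrArg star (supProj_singleton_mul_eq_zero.mpr hck)
    rwa [star_mul, hksa, hp.isSelfAdjoint.star_eq, star_zero] at this
  have hvv : star (x * y * p) * (x * y * p) = p := by
    rw [star_mul, star_mul, hp.isSelfAdjoint.star_eq, hysa]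
    have : p * (y * star x) * (x * y * p) = p * ((y * (star x * x) * y) * p) := by
      simp only [mul_assoc]
    rw [this, ← hb, hyby, sub_mul, one_mul, smul_mul_assoc, hkp, smul_zero, sub_zero,
      hp.isIdempotentElem.eq]
  have hv := Implements.of_right hp hvv
  refine ⟨_, p, hv.isStarProjection_left, hp, ?_, ?_, hv.equivalent, ?_⟩
  · refine projLE_of_mul_eq_left hv.isStarProjection_left he ?_
    rw [hx]
    simp only [mul_assoc]
    rw [mul_mul_of_mul_eq he.isIdempotentElem.eq]
  · refine projLE_of_mul_eq_zero (fun w hw => supProj_singleton_mul_eq_zero.mpr ?_) hf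
    rw [hmb, hb, hx]
    simp only [mul_assoc]
    rw [hw]
    simp only [mul_zero]
  · intro hp0
    have hc0 : c = 0 := by
      rw [← mul_supProj_singleton c, show supProj {c} = 0 from hp0, mul_zero]
    rw [hc, ← cfc_zero ℝ b, cfc_eq_cfc_iff_eqOn] at hc0
    have := hc0 ht
    simp only [Pi.zero_apply] at this
    have h2 := le_max_left (t - ε) 0
    linarith

/-- Two projections `e`, `f` are cut by a commuting projection `r` into a part where they are
equivalent and a part where they are orthogonal. -/
theorem exists_equivalent_cut {e f : A} (he : IsStarProjection e) (hf : IsStarProjection f) :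
    ∃ r : A, IsStarProjection r ∧ r * e = e * r ∧ r * f = f * r ∧
      Equivalent (e * r) (f * r) ∧ e * (f * (1 - r)) = 0 := by
  have hee := he.isIdempotentElem.eq
  have hff := hf.isIdempotentElem.eq
  -- Since `u e = f u`, the symmetry `s` in the polar decomposition `u = s |u|` also intertwines `e`
  -- and `f`, and `r = s²` is the support of `u`. Off `r` orthogonality appears because `e u = e f`.
  set u := e + f - 1 with hu
  have husa : IsSelfAdjoint u := (he.isSelfAdjoint.add hf.isSelfAdjoint).sub (.one A)
  set a := cfc (fun s : ℝ => |s|) u with ha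
  set c := cfc (fun s : ℝ => max s 0) u with hc
  set d := cfc (fun s : ℝ => max (-s) 0) u with hd
  have hcd : c * d = 0 := by
    rw [hc, hd, ← cfc_mul .., ← cfc_zero ℝ u]
    refine cfc_congr fun s _ => ?_
    rcases le_total s 0 with h | h <;> simp [h]
  have hcsub : c - d = u := by
    conv_rhs => rw [← cfc_id ℝ u]
    rw [hc, hd, ← cfc_sub ..]
    refine cfc_congr fun s _ => ?_
    rcases le_total s 0 with h | h <;> simp [h]
  have hcadd : c + d = a := by
    rw [hc, hd, ha, ← cfc_add ..]
    refine cfc_congr fun s _ => ?_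
    rcases le_total s 0 with h | h <;> simp [h, abs_of_nonpos, abs_of_nonneg]
  have hasa : star a = a := (IsSelfAdjoint.cfc (f := fun s : ℝ => |s|)).star_eq
  have hcsa : star c = c := (IsSelfAdjoint.cfc (f := fun s : ℝ => max s 0)).star_eq
  have hdsa : star d = d := (IsSelfAdjoint.cfc (f := fun s : ℝ => max (-s) 0)).star_eq
  have hdc : d * c = 0 := by
    have := congrArg star hcd
    rwa [star_mul, hcsa, hdsa, star_zero] at this
  -- Only `u²` commutes with `e` and `f`, not `u` itself, so `|u|` is rewritten as a function of
  -- `u²`.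
  have haa : a = cfc Real.sqrt (u * u) := by
    have : u * u = cfc (fun s : ℝ => s * s) u := by
      rw [cfc_mul (fun s : ℝ => s) (fun s : ℝ => s) u]
      rw [show cfc (fun s : ℝ => s) u = u from cfc_id ℝ u]
    rw [this, ← cfc_comp' Real.sqrt (fun s : ℝ => s * s) u, ha]
    exact cfc_congr fun s _ => (Real.sqrt_mul_self_eq_abs s).symm
  have hue : u * e = f * e := by rw [hu, sub_mul, add_mul, hee, one_mul]; abel
  have hfu : f * u = f * e := by rw [hu, mul_sub, mul_add, hff, mul_one]; abel
  have hue' : e * u = e * f := by rw [hu, mul_sub, mul_add, hee, mul_one]; abel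
  have huf : u * f = e * f := by rw [hu, sub_mul, add_mul, hff, one_mul]; abel
  have hcomm : ∀ g : A, u * u * g = g * (u * u) → a * g = g * a := fun g hg => by
    rw [haa]
    exact ((show Commute (u * u) g from hg).cfc_real Real.sqrt).eq
  have hae : a * e = e * a := hcomm e (by
    rw [mul_assoc, hue, ← mul_assoc, huf, ← mul_assoc, hue', mul_assoc, mul_assoc, hfu])
  have haf : a * f = f * a := hcomm f (by
    rw [mul_assoc, huf, ← mul_assoc, hue, ← mul_assoc, hfu, mul_assoc, mul_assoc, hue'])
  have hp := isStarProjection_supProj {c}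
  have hn := isStarProjection_supProj {d}
  have hcp := mul_supProj_singleton c
  have hdn := mul_supProj_singleton d
  have hpann : ∀ x, supProj {c} * x = 0 ↔ c * x = 0 := fun x => supProj_singleton_mul_eq_zero
  have hnann : ∀ x, supProj {d} * x = 0 ↔ d * x = 0 := fun x => supProj_singleton_mul_eq_zero
  set p := supProj {c}
  set n := supProj {d}
  have hpc : p * c = c := by
    have := congrArg star hcp
    rwa [star_mul, hcsa, hp.isSelfAdjoint.star_eq] at this
  have hnd : n * d = d := by
    have := congrArg star hdn
    rwa [star_mul, hdsa, hn.isSelfAdjoint.star_eq] at this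
  have hpd : p * d = 0 := (hpann d).mpr hcd
  have hnc : n * c = 0 := (hnann c).mpr hdc
  have hdp : d * p = 0 := by
    have := congrArg star hpd
    rwa [star_mul, hdsa, hp.isSelfAdjoint.star_eq, star_zero] at this
  have hnp : n * p = 0 := (hnann p).mpr hdp
  have hpn : p * n = 0 := mul_eq_zero_symm hn hp hnp
  set s := p - n with hs
  have hr : IsStarProjection (p + n) := hp.add hn hpn
  set r := p + n with hrdef
  have hssa : star s = s := (hp.isSelfAdjoint.sub hn.isSelfAdjoint).star_eq
  have hss : s * s = r := by
    rw [hs, hrdef, sub_mul, mul_sub, mul_sub, hpn, hnp, hp.isIdempotentElem.eq,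
      hn.isIdempotentElem.eq]
    abel
  have hrs : r * s = s := by
    rw [hs, hrdef, add_mul, mul_sub, mul_sub, hpn, hnp, hp.isIdempotentElem.eq,
      hn.isIdempotentElem.eq]
    abel
  have hsa : s * a = u := by
    rw [hs, ← hcadd, ← hcsub, sub_mul, mul_add, mul_add, hpc, hpd, hnc, hnd]
    abel
  have har : a * r = a := by
    have hcn : c * n = 0 := by
      have := congrArg star hnc
      rwa [star_mul, hcsa, hn.isSelfAdjoint.star_eq, star_zero] at this
    rw [← hcadd, hrdef, mul_add, add_mul, add_mul, hcp, hdp, hcn, hdn]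
    abel
  have hann : ∀ x, a * x = 0 → r * x = 0 := fun x hx => by
    have h1 : star (c * x) * (c * x) = 0 := by
      have : c * (a * x) = c * (c * x) := by
        rw [← hcadd, add_mul, mul_add, mul_mul_of_mul_eq hcd, zero_mul, add_zero]
      rw [star_mul, hcsa, mul_assoc, ← this, hx, mul_zero, mul_zero]
    have h2 : star (d * x) * (d * x) = 0 := by
      have : d * (a * x) = d * (d * x) := by
        rw [← hcadd, add_mul, mul_add, mul_mul_of_mul_eq hdc, zero_mul, zero_add]
      rw [star_mul, hdsa, mul_assoc, ← this, hx, mul_zero, mul_zero]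
    rw [CStarRing.star_mul_self_eq_zero_iff] at h1 h2
    rw [hrdef, add_mul, (hpann x).mpr h1, (hnann x).mpr h2, add_zero]
  have hrcomm : ∀ g : A, IsStarProjection g → a * g = g * a → r * g = g * r := fun g hg hag => by
    have h1 : r * (g * (1 - r)) = 0 := hann _ (by
      rw [← mul_assoc, hag, mul_assoc, mul_sub, mul_one, har, sub_self, mul_zero])
    rw [mul_sub, mul_sub, mul_one, sub_eq_zero] at h1
    have h2 := congrArg star h1
    simp only [star_mul, hg.isSelfAdjoint.star_eq, hr.isSelfAdjoint.star_eq] at h2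
    rw [h1, ← mul_assoc]
    exact h2.symm
  have hre := hrcomm e he hae
  have hrf := hrcomm f hf haf
  have hse : e * s = s * f := by
    have h1 : (s * e - f * s) * a = 0 := by
      rw [sub_mul, mul_assoc, ← hae, ← mul_assoc, hsa, mul_assoc, hsa, hue, hfu, sub_self]
    have h2 := congrArg star h1
    rw [star_mul, star_sub, star_mul, star_mul, hasa, hssa, he.isSelfAdjoint.star_eq,
      hf.isSelfAdjoint.star_eq, star_zero] at h2
    have h3 := hann _ h2
    rwa [mul_sub, ← mul_assoc, hre, mul_assoc, hrs, mul_mul_of_mul_eq hrs, sub_eq_zero] at h3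
  refine ⟨r, hr, hre, hrf, ⟨e * s, ?_, ?_⟩, ?_⟩
  · rw [star_mul, hssa, he.isSelfAdjoint.star_eq, mul_assoc, mul_mul_of_mul_eq hss, hre,
      mul_mul_of_mul_eq hee]
  · rw [star_mul, hssa, he.isSelfAdjoint.star_eq, mul_assoc, mul_mul_of_mul_eq hee, hse,
      mul_mul_of_mul_eq hss, hrf]
  · have h1 : u * (1 - r) = 0 := by
      rw [← hsa, mul_assoc, mul_sub, mul_one, har, sub_self, mul_zero]
    rw [← mul_assoc, ← hue', mul_assoc, h1, mul_zero]

/-- Equivalence is additive over orthogonal families with orthogonal suprema. -/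
theorem famSup_equivalent {I : Type*} {p q : I → A} (hp : IsOrthFamily p) (hq : IsOrthFamily q)
    (hpq : ∀ i j, p i * q j = 0) (h : ∀ i, Equivalent (p i) (q i)) :
    Equivalent (famSup p) (famSup q) := by
  choose w hw using fun i => (h i).exists_implements (hq.1 i)
  have hqp : ∀ i j, q i * p j = 0 := fun i j => mul_eq_zero_symm (hp.1 j) (hq.1 i) (hpq j i)
  -- The `w i` cannot be summed directly, but their graph projections `g i` have a supremum. The
  -- off-diagonal corner of that supremum, doubled, is the required partial isometry `x`.
  set g : I → A := fun i => (1 / 2 : ℝ) • (p i + q i + w i + star (w i)) with hg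
  have hgp : ∀ i, IsStarProjection (g i) := fun i => (hw i).isStarProjection_graph (hpq i i)
  have hG : IsStarProjection (famSup g) := isStarProjection_famSup
  have hpw : ∀ i j, i ≠ j → p i * w j = 0 := fun i j hij => by
    rw [← (hw j).left_mul, mul_mul_of_mul_eq (hp.2 i j hij), zero_mul]
  have hqw : ∀ i j, q i * w j = 0 := fun i j => by
    rw [← (hw j).left_mul, mul_mul_of_mul_eq (hqp i j), zero_mul]
  have hpw' : ∀ i j, p i * star (w j) = 0 := fun i j => by
    rw [← (hw j).symm.left_mul, mul_mul_of_mul_eq (hpq i j), zero_mul]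
  have hqw' : ∀ i j, i ≠ j → q i * star (w j) = 0 := fun i j hij => by
    rw [← (hw j).symm.left_mul, mul_mul_of_mul_eq (hq.2 i j hij), zero_mul]
  set k : I → A := fun i => p i + q i with hk
  have hkp : ∀ i, IsStarProjection (k i) := fun i => (hp.1 i).add (hq.1 i) (hpq i i)
  have hkg : ∀ i j, i ≠ j → k i * g j = 0 := fun i j hij => by
    simp only [hk, hg, mul_smul_comm, mul_add, add_mul, hp.2 i j hij, hq.2 i j hij, hpq, hqp,
      hpw i j hij, hqw, hpw', hqw' i j hij, add_zero, smul_zero]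
  have hkg' : ∀ i, k i * g i = g i := fun i => by
    simp only [hk, hg, mul_smul_comm, mul_add, add_mul, hpq, hqp, hqw, hpw',
      (hp.1 i).isIdempotentElem.eq, (hq.1 i).isIdempotentElem.eq, (hw i).left_mul,
      (hw i).symm.left_mul, add_zero, zero_add]
  have hgk : ∀ i, g i * k i = g i := fun i => by
    have := congrArg star (hkg' i)
    rwa [star_mul, (hgp i).isSelfAdjoint.star_eq, (hkp i).isSelfAdjoint.star_eq] at this
  -- The block `k i` meets no `g j` with `j ≠ i`, so compressing the supremum to this block recovers
  -- exactly `g i`.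
  have hGk : ∀ i, famSup g * k i = g i := fun i => by
    have h1 : famSup g * (k i - g i) = 0 := famSup_mul_eq_zero.mpr fun j => by
      by_cases hij : i = j
      · subst hij
        rw [mul_sub, hgk, (hgp i).isIdempotentElem.eq, sub_self]
      · have h2 : g j * k i = 0 := mul_eq_zero_symm (hkp i) (hgp j) (hkg i j hij)
        rw [mul_sub, h2, ← hkg' i, mul_mul_of_mul_eq h2, zero_mul, sub_zero]
    rw [mul_sub, sub_eq_zero] at h1
    rw [h1]
    exact (projLE_famSup i).mul_eq_left (hgp i) hG
  have hkG : ∀ i, k i * famSup g = g i := fun i => by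
    have := congrArg star (hGk i)
    rwa [star_mul, hG.isSelfAdjoint.star_eq, (hkp i).isSelfAdjoint.star_eq,
      (hgp i).isSelfAdjoint.star_eq] at this
  have hP : IsStarProjection (famSup p) := isStarProjection_famSup
  have hQ : IsStarProjection (famSup q) := isStarProjection_famSup
  have hpP : ∀ i, p i * famSup p = p i := fun i => (projLE_famSup i).mul_eq
  have hPp : ∀ i, famSup p * p i = p i := fun i =>
    (projLE_famSup (p := p) i).mul_eq_left (hp.1 i) hP
  have hqQ : ∀ i, q i * famSup q = q i := fun i => (projLE_famSup i).mul_eq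
  have hQq : ∀ i, famSup q * q i = q i := fun i =>
    (projLE_famSup (p := q) i).mul_eq_left (hq.1 i) hQ
  have hpk : ∀ i, p i * k i = p i := fun i => by
    rw [hk, mul_add, (hp.1 i).isIdempotentElem.eq, hpq, add_zero]
  have hqk : ∀ i, q i * k i = q i := fun i => by
    rw [hk, mul_add, (hq.1 i).isIdempotentElem.eq, hqp, zero_add]
  have hpg : ∀ i, p i * g i = (1 / 2 : ℝ) • (p i + w i) := fun i => by
    simp only [hg, mul_smul_comm, mul_add, hpq, hpw', (hp.1 i).isIdempotentElem.eq,
      (hw i).left_mul, add_zero]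
  have hqg : ∀ i, q i * g i = (1 / 2 : ℝ) • (q i + star (w i)) := fun i => by
    simp only [hg, mul_smul_comm, mul_add, hqp, hqw, (hq.1 i).isIdempotentElem.eq,
      (hw i).symm.left_mul, add_zero, zero_add]
  have hPQ : famSup p * famSup q = 0 := famSup_mul_famSup hp.1 hq.1 hpq
  have hQP := mul_eq_zero_symm hP hQ hPQ
  have hpQ : ∀ i, p i * famSup q = 0 := fun i => by
    rw [← hpP, mul_assoc, hPQ, mul_zero]
  have hqP : ∀ i, q i * famSup p = 0 := fun i => by
    rw [← hqQ, mul_assoc, hQP, mul_zero]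
  have hwQ : ∀ i, w i * famSup q = w i := fun i => by
    rw [← (hw i).mul_right, mul_assoc, hqQ]
  have hwP : ∀ i, star (w i) * famSup p = star (w i) := fun i => by
    rw [← (hw i).symm.mul_right, mul_assoc, hpP]
  set x := (2 : ℝ) • (famSup p * famSup g * famSup q) with hx
  have hxs : star x = (2 : ℝ) • (famSup q * famSup g * famSup p) := by
    rw [hx, star_smul, star_mul, star_mul, hP.isSelfAdjoint.star_eq, hQ.isSelfAdjoint.star_eq,
      hG.isSelfAdjoint.star_eq, star_trivial, mul_assoc]
  have hpx : ∀ i, p i * x = w i := fun i => by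
    rw [hx, mul_smul_comm, mul_assoc, mul_mul_of_mul_eq (hpP i), ← mul_assoc, ← hpk i,
      mul_assoc (p i), hkG, hpg, smul_mul_assoc, add_mul, hpQ, hwQ, zero_add, smul_smul]
    norm_num
  have hqx : ∀ i, q i * star x = star (w i) := fun i => by
    rw [hxs, mul_smul_comm, mul_assoc, mul_mul_of_mul_eq (hqQ i), ← mul_assoc, ← hqk i,
      mul_assoc (q i), hkG, hqg, smul_mul_assoc, add_mul, hqP, hwP, zero_add, smul_smul]
    norm_num
  have hPx : famSup p * x = x := by
    rw [hx, mul_smul_comm, mul_assoc, mul_mul_of_mul_eq hP.isIdempotentElem.eq]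
  have hQx : famSup q * star x = star x := by
    rw [hxs, mul_smul_comm, mul_assoc, mul_mul_of_mul_eq hQ.isIdempotentElem.eq]
  have hwx : ∀ i, w i * star x = p i := fun i => by
    rw [← (hw i).mul_right, mul_assoc, hqx, (hw i).mul_star_eq]
  have hwx' : ∀ i, star (w i) * x = q i := fun i => by
    rw [← (hw i).symm.mul_right, mul_assoc, hpx, (hw i).star_mul_eq]
  -- Each identity is tested against the individual `p i` or `q i`, since a supremum kills whatever
  -- all its members kill.
  refine ⟨x, ?_, ?_⟩
  · have : famSup p * (x * star x - famSup p) = 0 := famSup_mul_eq_zero.mpr fun i => by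
      rw [mul_sub, ← mul_assoc, hpx, hwx, hpP, sub_self]
    rw [mul_sub, ← mul_assoc, hPx, hP.isIdempotentElem.eq, sub_eq_zero] at this
    exact this.symm
  · have : famSup q * (star x * x - famSup q) = 0 := famSup_mul_eq_zero.mpr fun i => by
      rw [mul_sub, ← mul_assoc, hqx, hwx', hqQ, sub_self]
    rw [mul_sub, ← mul_assoc, hQx, hQ.isIdempotentElem.eq, sub_eq_zero] at this
    exact this.symm

/-! ### Zorn's lemma, generalized comparability and Schröder–Bernstein. -/

theorem exists_maximal_pairwise {α : Type*} (P : α → Prop) (R : α → α → Prop) (S₀ : Set α)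
    (hP : ∀ x ∈ S₀, P x) (hR : S₀.Pairwise R) :
    ∃ S, S₀ ⊆ S ∧ (∀ x ∈ S, P x) ∧ S.Pairwise R ∧
      ∀ x, P x → (∀ y ∈ S, R x y ∧ R y x) → x ∈ S := by
  obtain ⟨S, hS₀, hS⟩ := zorn_subset_nonempty {S : Set α | (∀ x ∈ S, P x) ∧ S.Pairwise R}
    (fun c hc hchain _ => ⟨⋃₀ c, ⟨fun x ⟨t, ht, hx⟩ => (hc ht).1 x hx,
      (Set.pairwise_sUnion hchain.directedOn).mpr fun t ht => (hc ht).2⟩,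
      fun t ht => Set.subset_sUnion_of_mem ht⟩) S₀ ⟨hP, hR⟩
  refine ⟨S, hS₀, hS.prop.1, hS.prop.2, fun x hx hxS => ?_⟩
  refine hS.le_of_ge ⟨?_, ?_⟩ (Set.subset_insert x S) (Set.mem_insert x S)
  · rintro y (rfl | hy)
    exacts [hx, hS.prop.1 y hy]
  · exact hS.prop.2.insert fun y hy _ => hxS y hy

/-- Generalized comparability of orthogonal projections. -/
theorem exists_comparison_of_orthogonal {e f : A} (he : IsStarProjection e)
    (hf : IsStarProjection f) (hef : e * f = 0) :
    ∃ z : A, IsCentralProjection z ∧ Subequivalent (z * e) (z * f) ∧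
      Subequivalent ((1 - z) * f) ((1 - z) * e) := by
  obtain ⟨S, -, hS, hR, hmax⟩ := exists_maximal_pairwise
    (fun x : A × A => IsStarProjection x.1 ∧ IsStarProjection x.2 ∧ ProjLE x.1 e ∧
      ProjLE x.2 f ∧ Equivalent x.1 x.2)
    (fun x y => x.1 * y.1 = 0 ∧ x.2 * y.2 = 0) ∅ (by simp) (by simp)
  set p : S → A := fun s => s.1.1 with hp
  set q : S → A := fun s => s.1.2 with hq
  have hpO : IsOrthFamily p := ⟨fun s => (hS s s.2).1, fun s t h =>
    (hR s.2 t.2 (Subtype.coe_ne_coe.mpr h)).1⟩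
  have hqO : IsOrthFamily q := ⟨fun s => (hS s s.2).2.1, fun s t h =>
    (hR s.2 t.2 (Subtype.coe_ne_coe.mpr h)).2⟩
  have hpq : ∀ i j, p i * q j = 0 := fun i j => by
    have h1 := (hS i i.2).2.2.1.mul_eq
    have h2 := (hS j j.2).2.2.2.1.mul_eq_left (hqO.1 j) hf
    change p i * e = p i at h1
    change f * q j = q j at h2
    rw [← h1, ← h2, mul_assoc, mul_mul_of_mul_eq hef, zero_mul, mul_zero]
  have hequiv := famSup_equivalent hpO hqO hpq fun s => (hS s s.2).2.2.2.2
  have hple : ProjLE (famSup p) e := famSup_projLE he fun s => (hS s s.2).2.2.1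
  have hqle : ProjLE (famSup q) f := famSup_projLE hf fun s => (hS s s.2).2.2.2.1
  have hP : IsStarProjection (famSup p) := isStarProjection_famSup
  have hQ : IsStarProjection (famSup q) := isStarProjection_famSup
  -- A nonzero corner between the two remainders would supply a further equivalent pair,
  -- contradicting maximality. Hence a central projection separates the remainders.
  have hzero : ∀ a, (e - famSup p) * a * (f - famSup q) = 0 := by
    by_contra! hcon
    obtain ⟨a, ha⟩ := hcon
    obtain ⟨p', q', hp', hq', hpe, hqf, hpq', hq0⟩ :=
      exists_equivalent_of_mul_mul_ne_zero (hple.sub hP he) (hqle.sub hQ hf) ha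
    have h1 : ∀ s : S, p s * p' = 0 := famSup_mul_eq_zero.mp (by
      rw [← hpe.mul_eq_left hp' (hple.sub hP he), ← mul_assoc, mul_sub_eq_zero hple hP, zero_mul])
    have h2 : ∀ s : S, q s * q' = 0 := famSup_mul_eq_zero.mp (by
      rw [← hqf.mul_eq_left hq' (hqle.sub hQ hf), ← mul_assoc, mul_sub_eq_zero hqle hQ, zero_mul])
    have hmem : (p', q') ∈ S := hmax (p', q')
      ⟨hp', hq', hpe.trans (projLE_sub hple he), hqf.trans (projLE_sub hqle hf), hpq'⟩
      fun s hs => ⟨⟨mul_eq_zero_symm (hS s hs).1 hp' (h1 ⟨s, hs⟩),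
        mul_eq_zero_symm (hS s hs).2.1 hq' (h2 ⟨s, hs⟩)⟩, h1 ⟨s, hs⟩, h2 ⟨s, hs⟩⟩
    exact hq0 (hq'.isIdempotentElem.eq.symm.trans (h2 ⟨_, hmem⟩))
  obtain ⟨w, hw, hew, hwf⟩ := exists_central_of_mul_mul_eq_zero hzero
  have h1 : (1 - w) * e = (1 - w) * famSup p := by
    rwa [← hw.one_sub.2, mul_sub, sub_eq_zero] at hew
  have h2 : (1 - (1 - w)) * f = (1 - (1 - w)) * famSup q := by
    rwa [sub_sub_cancel, ← sub_eq_zero, ← mul_sub]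
  refine ⟨1 - w, hw.one_sub, ?_, ?_⟩
  · rw [h1]
    exact ⟨_, hw.one_sub.mul_isStarProjection hQ, hequiv.central_mul hQ hw.one_sub,
      hw.one_sub.mul_projLE_mul hqle⟩
  · rw [h2]
    exact ⟨_, hw.one_sub.one_sub.mul_isStarProjection hP,
      hequiv.symm.central_mul hP hw.one_sub.one_sub, hw.one_sub.one_sub.mul_projLE_mul hple⟩

/-- Generalized comparability. -/
theorem exists_comparison {e f : A} (he : IsStarProjection e) (hf : IsStarProjection f) :
    ∃ z : A, IsCentralProjection z ∧ Subequivalent (z * e) (z * f) ∧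
      Subequivalent ((1 - z) * f) ((1 - z) * e) := by
  -- The parts under `r` are already equivalent and the parts under `1 - r` are orthogonal, so only
  -- the latter need comparing.
  obtain ⟨r, hr, hre, hrf, hequiv, horth⟩ := exists_equivalent_cut he hf
  have her : IsStarProjection (e * r) := he.mul hr hre.symm
  have hfr : IsStarProjection (f * r) := hf.mul hr hrf.symm
  have hre' : (1 - r) * e = e * (1 - r) := by rw [sub_mul, mul_sub, hre, one_mul, mul_one]
  have hrf' : (1 - r) * f = f * (1 - r) := by rw [sub_mul, mul_sub, hrf, one_mul, mul_one]
  have he' : IsStarProjection (e * (1 - r)) := he.mul hr.one_sub hre'.symm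
  have hf' : IsStarProjection (f * (1 - r)) := hf.mul hr.one_sub hrf'.symm
  obtain ⟨z, hz, h1, h2⟩ := exists_comparison_of_orthogonal he' hf' (by
    rw [← hre', mul_assoc, horth, mul_zero])
  refine ⟨z, hz, ?_, ?_⟩
  · rw [← add_mul_one_sub e r, ← add_mul_one_sub f r, mul_add, mul_add]
    refine ((hequiv.subequivalent hfr).central_mul hz).add (hz.mul_isStarProjection hfr)
      (hz.mul_isStarProjection hf') h1 ?_ ?_
    · rw [hz.mul_mul_mul, mul_mul_one_sub_eq_zero hr hre, mul_zero]
    · rw [hz.mul_mul_mul, mul_mul_one_sub_eq_zero hr hrf, mul_zero]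
  · have hz' := hz.one_sub
    rw [← add_mul_one_sub e r, ← add_mul_one_sub f r, mul_add, mul_add]
    refine ((hequiv.symm.subequivalent her).central_mul hz').add (hz'.mul_isStarProjection her)
      (hz'.mul_isStarProjection he') h2 ?_ ?_
    · rw [hz'.mul_mul_mul, mul_mul_one_sub_eq_zero hr hrf, mul_zero]
    · rw [hz'.mul_mul_mul, mul_mul_one_sub_eq_zero hr hre, mul_zero]

/-- The Schröder–Bernstein theorem for projections. -/
theorem Subequivalent.antisymm {e f : A} (he : IsStarProjection e) (hf : IsStarProjection f)
    (hef : Subequivalent e f) (hfe : Subequivalent f e) : Equivalent e f := by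
  obtain ⟨e', he', hee, hle⟩ := hef
  obtain ⟨f', hf', hff, hle'⟩ := hfe
  obtain ⟨v, hv⟩ := hee.exists_implements he'
  obtain ⟨w, hw⟩ := hff.exists_implements hf'
  -- Conjugation by `t` maps `e` into `f'`. The supremum `P` of the iterated images of `e - f'`
  -- satisfies `P = (e - f') + t* P t`. Hence `v` carries `P` into `f`, and `w` carries what is left
  -- of `f` onto `e - P`.
  set t := v * w with ht
  have hvf : v * f = v := by rw [← hv.mul_right, mul_assoc, hle.mul_eq]
  have htt : t * star t = e := by
    rw [ht, star_mul, mul_assoc, mul_mul_of_mul_eq hw.mul_star_eq, ← mul_assoc, hvf,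
      hv.mul_star_eq]
  have hte : e * star t = star t := by
    rw [ht, star_mul, ← hw.symm.left_mul, ← mul_assoc, ← mul_assoc, hle'.mul_eq_left hf' he]
  have hf't : f' * star t = star t := by
    rw [ht, star_mul, ← mul_assoc, hw.symm.left_mul]
  let p : ℕ → A := fun n => n.rec (e - f') fun _ a => star t * a * t
  have hp0 : p 0 = e - f' := rfl
  have hps : ∀ n, p (n + 1) = star t * p n * t := fun n => rfl
  have hpe : ∀ n, e * p n = p n := fun n => by
    cases n with
    | zero => rw [hp0, mul_sub, he.isIdempotentElem.eq, hle'.mul_eq_left hf' he]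
    | succ n => rw [hps, mul_assoc, mul_mul_of_mul_eq hte]
  have hpsa : ∀ n, star (p n) = p n := fun n => by
    induction n with
    | zero => rw [hp0, star_sub, he.isSelfAdjoint.star_eq, hf'.isSelfAdjoint.star_eq]
    | succ n ih => rw [hps, star_mul _ t, star_mul (star t), star_star, ih, mul_assoc]
  have hP : IsStarProjection (famSup p) := isStarProjection_famSup
  have hPe : ProjLE (famSup p) e := projLE_of_mul_eq_zero (fun x hx =>
    famSup_mul_eq_zero.mpr fun n => by
      have := congrArg star (hpe n)
      rw [star_mul, hpsa, he.isSelfAdjoint.star_eq] at this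
      rw [← this, mul_assoc, hx, mul_zero]) he
  have hdiff : IsStarProjection (e - f') := hle'.sub hf' he
  have htimp : Implements t e (star t * t) := by
    have := Implements.of_right (v := star t) he (by rw [star_star, htt])
    simpa only [star_star] using this.symm
  have hcorner : IsStarProjection (star t * famSup p * t) :=
    (htimp.restrict hP hPe).isStarProjection_right
  have horth : (e - f') * (star t * famSup p * t) = 0 := by
    rw [mul_assoc, ← mul_assoc, sub_mul, hte, hf't, sub_self, zero_mul]
  have hfix : famSup p = (e - f') + star t * famSup p * t := by
    refine famSup_eq (hdiff.add hcorner horth) fun x => ?_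
    -- Multiplying by `t` undoes the conjugation, which matches the annihilator of `t* P t` with
    -- those of the shifted terms `p (n + 1)`.
    have hcancel : ∀ a, e * a = a → (star t * a * t * x = 0 ↔ a * (t * x) = 0) := fun a ha => by
      constructor
      · intro h
        have := congrArg (t * ·) h
        simp only [mul_assoc, mul_zero] at this
        rwa [mul_mul_of_mul_eq htt, mul_mul_of_mul_eq ha] at this
      · intro h
        rw [mul_assoc, mul_assoc, h, mul_zero]
    rw [add_mul_eq_zero_iff hdiff horth, hcancel _ (hPe.mul_eq_left hP he), famSup_mul_eq_zero]
    constructor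
    · rintro ⟨h1, h2⟩ n
      cases n with
      | zero => exact h1
      | succ n => rw [hps, hcancel _ (hpe n)]; exact h2 n
    · intro h
      exact ⟨h 0, fun n => (hcancel _ (hpe n)).mp (by rw [← hps]; exact h (n + 1))⟩
  have h1 := hv.restrict hP hPe
  have hQ := h1.isStarProjection_right
  have hQf : ProjLE (star v * famSup p * v) f := (hv.restrict_le _).trans hle
  have h2 := hw.restrict (hQf.sub hQ hf) (projLE_sub hQf hf)
  have h3 : star w * (f - star v * famSup p * v) * w = e - famSup p := by
    rw [mul_sub, sub_mul, mul_assoc _ f, hw.left_mul, hw.star_mul_eq]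
    nth_rw 2 [hfix]
    rw [ht, star_mul]
    simp only [mul_assoc]
    abel
  rw [h3] at h2
  have := h1.equivalent.add hQ (hQf.sub hQ hf) h2.symm.equivalent (mul_sub_eq_zero hPe hP)
    (mul_sub_eq_zero hQf hQ)
  rwa [add_sub_cancel, add_sub_cancel] at this

end Comparison

open Cardinal

/-! ### Infinite families of copies of a projection. -/

section Infinite

/-- An infinite `J` splits into `J` blocks, each containing two disjoint copies of `J`;
`famSup_subequivalent` needs both copies. -/
theorem nonempty_prod_prod_bool_equiv (J : Type*) [Infinite J] :
    Nonempty (J × (J × Bool) ≃ J) := by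
  rw [← Cardinal.eq]
  have h := Cardinal.aleph0_le_mk J
  rw [Cardinal.mk_prod, Cardinal.mk_prod, Cardinal.lift_id, Cardinal.lift_uzero,
    Cardinal.mk_bool, Cardinal.lift_ofNat, Cardinal.lift_mul, Cardinal.lift_id,
    Cardinal.lift_ofNat, Cardinal.mul_eq_left h (Cardinal.ofNat_le_aleph0.trans h) two_ne_zero,
    Cardinal.mul_eq_self h]

variable {A : Type u} [CStarAlgebra A]

theorem IsOrthFamily.injective {I : Type*} {p : I → A} (hp : IsOrthFamily p)
    (h0 : ∀ i, p i ≠ 0) : Function.Injective p := fun i j hij => by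
  by_contra hne
  have := hp.2 i j hne
  rw [← hij, (hp.1 i).isIdempotentElem.eq] at this
  exact h0 i this

/-- The infimum defining `dim` is attained once its set is nonempty. For `e ≠ 0` a family in `Γ(e)`
is injective, so the successor of `#A` belongs to the set. -/
theorem lt_dim {e : A} (he0 : e ≠ 0) {I : Type u} {p : I → A} (hp : InGamma e p) :
    #I < dim e := by
  rw [dim, if_neg he0]
  refine csInf_mem (s := {κ : Cardinal.{u} | ∀ (I : Type u) (p : I → A), InGamma e p → #I < κ})
    ⟨Order.succ #A, fun J q hq => Order.lt_succ_of_le (mk_le_of_injective (f := q) ?_)⟩ I p hp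
  exact IsOrthFamily.injective ⟨hq.1.1, hq.1.2.1⟩ fun i hi => he0 ((hq.2 i).symm.eq_zero hi)

theorem dim_le {e : A} {κ : Cardinal.{u}}
    (h : ∀ (I : Type u) (p : I → A), InGamma e p → #I < κ) : dim e ≤ κ := by
  rw [dim]
  split_ifs
  · exact zero_le
  · exact csInf_le' h

theorem exists_inGamma_of_lt_dim {e : A} {κ : Cardinal.{u}} (h : κ < dim e) :
    ∃ (I : Type u) (p : I → A), InGamma e p ∧ κ ≤ #I := by
  by_contra! hcon
  exact (dim_le hcon).not_gt h

/-- If `v` implements `e ∼ f < e`, conjugation by `v` acts as a unilateral shift, and the successive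
images of the defect `e - f` are orthogonal copies of it. -/
theorem IsInfinite.exists_isOrthFamily {e : A} (he : IsInfinite e) :
    ∃ (q : A) (p : ℕ → A), IsStarProjection q ∧ q ≠ 0 ∧ ProjLE q e ∧ IsOrthFamily p ∧
      (∀ n, ProjLE (p n) e) ∧ ∀ n, Equivalent (p n) q := by
  obtain ⟨he, hinf⟩ := he
  simp only [IsFinite, not_and, not_forall] at hinf
  obtain ⟨f, hf, hef, hle, hne⟩ := hinf he
  obtain ⟨v, hv⟩ := hef.exists_implements hf
  let p : ℕ → A := fun n => n.rec (e - f) fun _ a => star v * a * v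
  have hps : ∀ n, p (n + 1) = star v * p n * v := fun n => rfl
  have hp : ∀ n, IsStarProjection (p n) ∧ ProjLE (p n) e := fun n => by
    induction n with
    | zero => exact ⟨hle.sub hf he, projLE_sub hle he⟩
    | succ n ih =>
      exact ⟨(hv.restrict ih.1 ih.2).isStarProjection_right, (hv.restrict_le _).trans hle⟩
  have hlt : ∀ m k, p m * p (m + 1 + k) = 0 := fun m k => by
    induction m with
    | zero =>
      refine mul_eq_zero_symm (hp _).1 (hp 0).1 ?_
      rw [show 0 + 1 + k = k + 1 by omega, hps]
      exact (hv.restrict_le (p k)).mul_eq_zero (mul_sub_eq_zero hle hf)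
    | succ m ih =>
      rw [show m + 1 + 1 + k = (m + 1 + k) + 1 by omega, hps, hps]
      simp only [mul_assoc]
      rw [mul_mul_of_mul_eq hv.mul_star_eq, mul_mul_of_mul_eq ((hp _).2.mul_eq_left (hp _).1 he),
        mul_mul_of_mul_eq ih, zero_mul, mul_zero]
  have hlt' : ∀ m n, m < n → p m * p n = 0 := fun m n h => by
    have := hlt m (n - (m + 1))
    rwa [show m + 1 + (n - (m + 1)) = n by omega] at this
  refine ⟨e - f, p, hle.sub hf he, sub_ne_zero.mpr hne, projLE_sub hle he,
    ⟨fun n => (hp n).1, fun m n h => ?_⟩, fun n => (hp n).2, fun n => ?_⟩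
  · rcases lt_or_gt_of_ne h with h | h
    exacts [hlt' m n h, mul_eq_zero_symm (hp n).1 (hp m).1 (hlt' n m h)]
  · induction n with
    | zero => exact .refl (hp 0).1
    | succ n ih =>
      exact (hv.restrict (hp n).1 (hp n).2).equivalent.symm.trans (hp n).1 ih

theorem IsProperlyInfinite.isInfinite {e : A} (he : IsProperlyInfinite e) : IsInfinite e := by
  have := he.2.2 1 ⟨.one A, fun a => by rw [one_mul, mul_one]⟩
  rw [one_mul] at this
  exact this.resolve_left he.2.1

variable [AWStarAlgebra A]

/-- The supremum of an orthogonal family of equivalent projections is subequivalent to any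
projection dominating two disjoint copies of the family inside itself. -/
theorem famSup_subequivalent {J : Type*} {g : J → A} {q : A} (hg : IsOrthFamily g)
    (hq : IsStarProjection q) (hgq : ∀ j, Equivalent (g j) q) {a b : J → J}
    (ha : Function.Injective a) (hb : Function.Injective b) (hab : ∀ i j, a i ≠ b j) {h : A}
    (hh : IsStarProjection h) (hah : ∀ j, ProjLE (g (a j)) h) (hbh : ∀ j, ProjLE (g (b j)) h) :
    Subequivalent (famSup g) h := by
  have heq : ∀ i j, Equivalent (g i) (g j) := fun i j => (hgq i).trans hq (hgq j).symm
  -- Equivalence is additive only between mutually orthogonal families. So the complement of the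
  -- range of `a` is moved into that range, and the range of `a` into the range of `b`.
  let c : ((Set.range a)ᶜ : Set J) → J := Subtype.val
  have hc : Function.Injective c := Subtype.val_injective
  have hca : ∀ i j, c i ≠ a j := fun i j hij => i.2 ⟨j, hij.symm⟩
  have h1 : Equivalent (famSup (g ∘ c)) (famSup (g ∘ (a ∘ c))) :=
    famSup_equivalent (hg.comp hc) (hg.comp (ha.comp hc)) (fun i j => hg.2 _ _ (hca i _))
      fun i => heq _ _
  have h2 : Equivalent (famSup (g ∘ a)) (famSup (g ∘ b)) :=
    famSup_equivalent (hg.comp ha) (hg.comp hb) (fun i j => hg.2 _ _ (hab i j)) fun i => heq _ _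
  have h3 : famSup (g ∘ c) * famSup (g ∘ a) = 0 :=
    famSup_mul_famSup (fun _ => hg.1 _) (fun _ => hg.1 _) fun i j => hg.2 _ _ (hca i j)
  have h4 : famSup (g ∘ (a ∘ c)) * famSup (g ∘ b) = 0 :=
    famSup_mul_famSup (fun _ => hg.1 _) (fun _ => hg.1 _) fun i j => hg.2 _ _ (hab _ j)
  have h5 : famSup g = famSup (g ∘ c) + famSup (g ∘ a) := by
    refine famSup_eq (isStarProjection_famSup.add isStarProjection_famSup h3) fun x => ?_
    rw [add_mul_eq_zero_iff isStarProjection_famSup h3, famSup_mul_eq_zero, famSup_mul_eq_zero]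
    constructor
    · rintro ⟨h6, h7⟩ j
      by_cases hj : j ∈ Set.range a
      · obtain ⟨i, rfl⟩ := hj
        exact h7 i
      · exact h6 ⟨j, hj⟩
    · exact fun h => ⟨fun i => h _, fun i => h _⟩
  rw [h5]
  exact ⟨_, isStarProjection_famSup.add isStarProjection_famSup h4,
    h1.add isStarProjection_famSup isStarProjection_famSup h2 h3 h4,
    projLE_add (famSup_projLE hh fun i => hah _) (famSup_projLE hh fun i => hbh _)⟩

/-- An infinite orthogonal family of equivalent projections can be regrouped into equally many
projections equivalent to its supremum. -/
theorem exists_regrouping {J : Type*} [Infinite J] {g : J → A} {q : A} (hg : IsOrthFamily g)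
    (hq : IsStarProjection q) (hgq : ∀ j, Equivalent (g j) q) :
    ∃ R : J → A, IsOrthFamily R ∧ famSup R = famSup g ∧ ∀ k, Equivalent (R k) (famSup g) := by
  obtain ⟨φ⟩ := nonempty_prod_prod_bool_equiv J
  set R : J → A := fun k => famSup fun x => g (φ (k, x)) with hR
  have hRp : ∀ k, IsStarProjection (R k) := fun k => isStarProjection_famSup
  have hle : ∀ k x, ProjLE (g (φ (k, x))) (R k) := fun k x =>
    projLE_famSup (p := fun x => g (φ (k, x))) x
  have hRle : ∀ k, ProjLE (R k) (famSup g) := fun k =>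
    famSup_projLE isStarProjection_famSup fun x => projLE_famSup _
  refine ⟨R, ⟨hRp, fun i j hij => famSup_mul_famSup (fun _ => hg.1 _) (fun _ => hg.1 _)
    fun x y => hg.2 _ _ (φ.injective.ne (by simp [hij]))⟩, ?_, fun k => ?_⟩
  · refine famSup_eq isStarProjection_famSup fun x => ?_
    simp only [hR, famSup_mul_eq_zero]
    constructor
    · exact fun h k y => h _
    · intro h j
      have := h (φ.symm j).1 (φ.symm j).2
      simpa using this
  · refine ((hRle k).subequivalent (hRp k)).antisymm (hRp k) isStarProjection_famSup ?_
    refine famSup_subequivalent hg hq hgq (a := fun j => φ (k, j, false))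
      (b := fun j => φ (k, j, true)) (fun i j h => ?_) (fun i j h => ?_) (fun i j h => ?_)
      (hRp k) (fun j => hle k _) (fun j => hle k _)
    · simpa using φ.injective h
    · simpa using φ.injective h
    · simpa using φ.injective h

/-- If `f` is the sum of an infinite orthogonal family of copies of `q` and a projection
subequivalent to `q`, the remainder can be absorbed. -/
theorem exists_inGamma_of_add {J : Type u} [Infinite J] {g : J → A} {q r : A}
    (hg : IsOrthFamily g) (hq : IsStarProjection q) (hgq : ∀ j, Equivalent (g j) q)
    (hr : IsStarProjection r) (hgr : famSup g * r = 0) (hrq : Subequivalent r q) :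
    Equivalent (famSup g + r) (famSup g) ∧ ∃ p : J → A, InGamma (famSup g + r) p := by
  obtain ⟨R, hR, hRg, hRequiv⟩ := exists_regrouping hg hq hgq
  have hG : IsStarProjection (famSup g) := isStarProjection_famSup
  have hf := hG.add hr hgr
  -- Two blocks of the regrouping suffice: `R k` receives `famSup g` and `R k'` receives `r`.
  obtain ⟨k, k', hk⟩ := exists_pair_ne J
  have hRle : ∀ k, ProjLE (R k) (famSup g) := fun k => hRg ▸ projLE_famSup k
  have hrR : Subequivalent r (R k') :=
    hrq.trans (((hgq k).symm.subequivalent (hg.1 k)).trans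
      (((projLE_famSup k).subequivalent (hg.1 k)).trans
        ((hRequiv k').symm.subequivalent (hR.1 k'))))
  have h1 : Subequivalent (famSup g + r) (famSup g) :=
    (((hRequiv k).symm.subequivalent (hR.1 k)).add (hR.1 k) (hR.1 k') hrR hgr
      (hR.2 k k' hk)).trans
      ((projLE_add (hRle k) (hRle k')).subequivalent ((hR.1 k).add (hR.1 k') (hR.2 k k' hk)))
  have h2 : Equivalent (famSup g + r) (famSup g) :=
    h1.antisymm hf hG ((projLE_add_left hG hgr).subequivalent hG)
  refine ⟨h2, ?_⟩
  obtain ⟨v, hv⟩ := h2.symm.exists_implements hf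
  obtain ⟨h3, h4, h5⟩ := hv.famSup_conj hR hRg
  refine ⟨_, h4 ▸ h3.isOrthogonalSum, fun i => ?_⟩
  exact (h5 i).symm.trans (hR.1 i) ((hRequiv i).trans hG h2.symm)

/-- A projection `e` containing infinitely many orthogonal copies of `q` is, over some central
projection, the sum of at least as many copies of `q`. -/
theorem exists_central_decomposition {e q : A} (he : IsStarProjection e)
    (hq : IsStarProjection q) (hq0 : q ≠ 0) {I : Type u} [Infinite I] {p : I → A}
    (hp : IsOrthFamily p) (hpe : ∀ i, ProjLE (p i) e) (hpq : ∀ i, Equivalent (p i) q) :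
    ∃ z : A, IsCentralProjection z ∧ z * q ≠ 0 ∧ ∃ (J : Type u) (g : J → A), Infinite J ∧
      #I ≤ #J ∧ IsOrthFamily g ∧ (∀ j, Equivalent (g j) (z * q)) ∧
      Equivalent (z * e) (famSup g) ∧ ∃ p' : J → A, InGamma (z * e) p' := by
  have hinj := hp.injective fun i hi => hq0 ((hpq i).symm.eq_zero hi)
  obtain ⟨S, hS₀, hS, hR, hmax⟩ := exists_maximal_pairwise
    (fun x : A => IsStarProjection x ∧ ProjLE x e ∧ Equivalent x q) (fun x y => x * y = 0)
    (Set.range p) (by rintro _ ⟨i, rfl⟩; exact ⟨hp.1 i, hpe i, hpq i⟩)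
    (by
      rintro _ ⟨i, rfl⟩ _ ⟨j, rfl⟩ hij
      exact hp.2 i j fun h => hij (by rw [h]))
  have hIS : #I ≤ #S := mk_le_of_injective (f := fun i => (⟨p i, hS₀ ⟨i, rfl⟩⟩ : S))
    fun i j h => hinj (Subtype.ext_iff.mp h)
  have hSinf : Infinite S := infinite_iff.mpr ((aleph0_le_mk I).trans hIS)
  let s : S → A := Subtype.val
  have hs : IsOrthFamily s := ⟨fun x => (hS x x.2).1, fun x y h =>
    hR x.2 y.2 (Subtype.coe_ne_coe.mpr h)⟩
  have hG : IsStarProjection (famSup s) := isStarProjection_famSup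
  have hle : ProjLE (famSup s) e := famSup_projLE he fun x => (hS x x.2).2.1
  have hr := hle.sub hG he
  -- Maximality: a copy of `q` in the remainder could be added to `S`.
  have hno : ¬ Subequivalent q (e - famSup s) := by
    rintro ⟨q', hq', hqq, hq'r⟩
    have h1 : ∀ x : S, s x * q' = 0 := famSup_mul_eq_zero.mp (by
      rw [← hq'r.mul_eq_left hq' hr, ← mul_assoc, mul_sub_eq_zero hle hG, zero_mul])
    have hmem : q' ∈ S := hmax q' ⟨hq', hq'r.trans (projLE_sub hle he), hqq.symm⟩
      fun y hy => ⟨mul_eq_zero_symm (hS y hy).1 hq' (h1 ⟨y, hy⟩), h1 ⟨y, hy⟩⟩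
    exact hq0 (hqq.eq_zero (hq'.isIdempotentElem.eq.symm.trans (h1 ⟨q', hmem⟩)))
  obtain ⟨z, hz, h1, h2⟩ := exists_comparison hr hq
  -- If `z q = 0`, then `q = (1 - z) q` would be subequivalent to the remainder.
  have hzq : z * q ≠ 0 := by
    intro h
    apply hno
    have h3 : (1 - z) * q = q := by rw [sub_mul, one_mul, h, sub_zero]
    rw [h3] at h2
    exact h2.trans ((mul_projLE _ hr).subequivalent (hz.one_sub.mul_isStarProjection hr))
  have hze : z * e = famSup (fun x => z * s x) + z * (e - famSup s) := by
    rw [hz.famSup_mul, ← mul_add, add_sub_cancel]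
  have hzs : IsOrthFamily (fun x => z * s x) := ⟨fun x => hz.mul_isStarProjection (hs.1 x),
    fun x y h => by rw [hz.mul_mul_mul, hs.2 x y h, mul_zero]⟩
  have hzsq : ∀ x, Equivalent (z * s x) (z * q) := fun x => (hS x x.2).2.2.central_mul hq hz
  obtain ⟨h3, h4⟩ := exists_inGamma_of_add hzs (hz.mul_isStarProjection hq) hzsq
    (hz.mul_isStarProjection hr)
    (by rw [hz.famSup_mul, hz.mul_mul_mul, mul_sub_eq_zero hle hG, mul_zero]) h1
  rw [← hze] at h3 h4
  exact ⟨z, hz, hzq, S, _, hSinf, hIS, hzs, hzsq, h3, h4⟩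

/-- An orthogonal sum of copies of `q` is subequivalent to `q` if `q` itself is a sum of at least
as many copies of `q`. -/
theorem famSup_subequivalent_of_inGamma {J : Type u} [Infinite J] {g : J → A} {q : A}
    (hg : IsOrthFamily g) (hq : IsStarProjection q) (hgq : ∀ j, Equivalent (g j) q)
    {K : Type u} {h : K → A} (hh : InGamma q h) (hJK : #J ≤ #K) :
    Subequivalent (famSup g) q := by
  obtain ⟨ι⟩ : Nonempty (J ↪ K) := hJK
  obtain ⟨φ⟩ := nonempty_prod_prod_bool_equiv J
  -- One index is freed: the whole sum fits into the sum over `j ≠ j₀`, which is orthogonal to `g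
  -- j₀`. The latter, being a copy of `q`, contains enough copies of `q` to match the remaining `g
  -- j`.
  obtain ⟨j₀⟩ : Nonempty J := inferInstance
  obtain ⟨k, hk⟩ := exists_ne (φ.symm j₀).1
  have hkj : ∀ x, φ (k, x) ≠ j₀ := fun x hx => hk (by rw [← hx, Equiv.symm_apply_apply])
  let c : {j // j ≠ j₀} → J := Subtype.val
  have hc : Function.Injective c := Subtype.val_injective
  have hle : ∀ x, ProjLE (g (φ (k, x))) (famSup (g ∘ c)) := fun x =>
    projLE_famSup (p := g ∘ c) ⟨φ (k, x), hkj x⟩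
  have h1 : Subequivalent (famSup g) (famSup (g ∘ c)) :=
    famSup_subequivalent hg hq hgq (a := fun j => φ (k, j, false)) (b := fun j => φ (k, j, true))
      (fun i j h => by simpa using φ.injective h) (fun i j h => by simpa using φ.injective h)
      (fun i j h => by simpa using φ.injective h) isStarProjection_famSup
      (fun j => hle _) (fun j => hle _)
  obtain ⟨v, hv⟩ := (hgq j₀).symm.exists_implements (hg.1 j₀)
  obtain ⟨h2, h3, h4⟩ := hv.famSup_conj hh.1.isOrthFamily hh.1.famSup_eq
  set h' : K → A := fun i => star v * h i * v
  have hle' : ∀ i, ProjLE (h' i) (g j₀) := fun i => h3 ▸ projLE_famSup i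
  have h5 : Equivalent (famSup (g ∘ c)) (famSup (h' ∘ (ι ∘ c))) :=
    famSup_equivalent (hg.comp hc) (h2.comp (ι.injective.comp hc))
      (fun i j => by
        have := (hle' (ι (c j))).mul_eq_left (h2.1 _) (hg.1 j₀)
        simp only [Function.comp_apply]
        rw [← this, mul_mul_of_mul_eq (hg.2 _ _ i.2), zero_mul])
      fun i => ((hgq _).trans hq (hh.2 _).symm).trans (hh.1.1 _) (h4 _)
  exact h1.trans ((h5.subequivalent isStarProjection_famSup).trans
    (((famSup_projLE (hg.1 j₀) fun i => hle' _).subequivalent isStarProjection_famSup).trans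
      ((hgq j₀).subequivalent hq)))

end Infinite

/-! ### Dimension, local comparison and central gluing. -/

section Dimension

variable {A : Type u} [CStarAlgebra A] [AWStarAlgebra A]

variable {e f : A}

/-- Replacing `z` by `z C(e)` leaves `z e` unchanged and meets the requirement `z ≤ C(e)`. -/
theorem IsEquidimensional.dim_central_mul (he : IsEquidimensional e) {z : A}
    (hz : IsCentralProjection z) (hze : z * e ≠ 0) : dim (z * e) = dim e := by
  rcases he with rfl | ⟨hpe, he⟩
  · rw [mul_zero]
  · obtain ⟨hc, hle, -⟩ := centralCover_spec e
    have h1 : z * centralCover e * e = z * e := by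
      rw [mul_assoc, hle.mul_eq_left hpe.1 hc.1]
    have h2 := he (z * centralCover e) (hz.mul hc) (fun h => hze (by rw [← h1, h, zero_mul]))
      (by rw [ProjLE, mul_assoc, hc.1.isIdempotentElem.eq])
    rwa [h1] at h2

/-- An infinite sequence of orthogonal equivalent subprojections yields an infinite family in `Γ(z
e)` for some `z`, and equidimensionality transfers the bound to `e`. Families in `Γ(e)` can then
always be chosen infinite. -/
theorem aleph0_lt_dim (he : IsProperlyInfinite e) (he' : IsEquidimensional e) :
    ℵ₀ < dim e := by
  obtain ⟨q, p, hq, hq0, hqe, hp, hpe, hpq⟩ := he.isInfinite.exists_isOrthFamily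
  obtain ⟨z, hz, hzq, J, g, hJ, -, -, -, -, p', hp'⟩ := exists_central_decomposition he.1 hq hq0
    (hp.comp (ULift.down_injective (α := ℕ)) : IsOrthFamily (fun n : ULift.{u} ℕ => p n.down))
    (fun i => hpe _) fun i => hpq _
  have hze : z * e ≠ 0 := fun h => hzq (by
    rw [← hqe.mul_eq_left hq he.1, ← mul_assoc, h, zero_mul])
  rw [← he'.dim_central_mul hz hze]
  exact (aleph0_le_mk J).trans_lt (lt_dim hze hp')

theorem exists_infinite_inGamma (he : IsProperlyInfinite e) (he' : IsEquidimensional e)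
    {κ : Cardinal.{u}} (hκ : κ < dim e) :
    ∃ (I : Type u) (p : I → A), Infinite I ∧ InGamma e p ∧ κ ≤ #I := by
  obtain ⟨I, p, hp, hI⟩ := exists_inGamma_of_lt_dim (max_lt hκ (aleph0_lt_dim he he'))
  exact ⟨I, p, infinite_iff.mpr ((le_max_right _ _).trans hI), hp, (le_max_left _ _).trans hI⟩

/-- A family in `Γ(e)` is transported into `f` as orthogonal copies of `e`. Over some central `z` it
grows to a decomposition that gives an at least equally large family in `Γ(z f)`, and `d(z f) =
d(f)`. -/
theorem Subequivalent.dim_le (he : IsProperlyInfinite e) (he' : IsEquidimensional e)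
    (hf : IsProperlyInfinite f) (hf' : IsEquidimensional f) (h : Subequivalent e f) :
    dim e ≤ dim f := by
  refine AWStar.dim_le fun I p hp => ?_
  obtain ⟨K, k, hK, hk, hIK⟩ := exists_infinite_inGamma he he' (lt_dim he.2.1 hp)
  have h0 := h
  obtain ⟨e', hep, hee, hle⟩ := h
  obtain ⟨v, hv⟩ := hee.exists_implements hep
  obtain ⟨h1, h2, h3⟩ := hv.famSup_conj hk.1.isOrthFamily hk.1.famSup_eq
  obtain ⟨z, hz, hze, J, g, hJ, hKJ, -, -, -, p', hp'⟩ :=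
    exists_central_decomposition hf.1 he.1 he.2.1 h1
      (fun i => (hv.restrict_le _).trans hle)
      fun i => (h3 i).symm.trans (hk.1.1 i) (hk.2 i)
  have hzf : z * f ≠ 0 := fun h => hze ((h0.central_mul hz).eq_zero h)
  rw [← hf'.dim_central_mul hz hzf]
  exact hIK.trans_lt (hKJ.trans_lt (lt_dim hzf hp'))

/-- A partial isometry fixed on the right by the central `C(f)` is fixed on the left too, so `C(f)`
dominates `e`. -/
theorem Subequivalent.centralCover_projLE (h : Subequivalent e f) :
    ProjLE (centralCover e) (centralCover f) := by
  obtain ⟨hcf, hle, -⟩ := centralCover_spec f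
  refine (centralCover_spec e).2.2 _ hcf ?_
  obtain ⟨e', he', hee, hle'⟩ := h
  obtain ⟨v, hv⟩ := hee.exists_implements he'
  have h1 : v * centralCover f = v := by
    rw [← hv.mul_right, mul_assoc, (hle'.trans hle).mul_eq]
  refine projLE_of_mul_eq_left hv.isStarProjection_left hcf.1 ?_
  rw [← hv.mul_star_eq, ← mul_assoc, hcf.2, h1]

theorem mul_eq_zero_of_centralCover_projLE
    (h : ProjLE (centralCover e) (centralCover f)) {w : A} (hw : IsCentralProjection w)
    (hwf : w * f = 0) : w * e = 0 := by
  have h1 : ProjLE f (1 - w) := by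
    rw [ProjLE, mul_sub, mul_one, ← hw.2, hwf, sub_zero]
  have h2 : ProjLE e (1 - w) := (centralCover_spec e).2.1.trans
    (h.trans ((centralCover_spec f).2.2 _ hw.one_sub h1))
  rw [hw.2]
  exact h2.mul_eq_zero hw.1.one_sub_mul_self

/-- Local form of the comparison of equidimensional projections. -/
theorem exists_central_subequivalent (he : IsProperlyInfinite e) (he' : IsEquidimensional e)
    (hf : IsProperlyInfinite f) (hf' : IsEquidimensional f)
    (hC : ProjLE (centralCover e) (centralCover f)) (hd : dim e ≤ dim f) {w : A}
    (hw : IsCentralProjection w) (hwe : w * e ≠ 0) :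
    ∃ z : A, IsCentralProjection z ∧ z * w = z ∧ z * e ≠ 0 ∧ Subequivalent (z * e) (z * f) := by
  have hwep := hw.mul_isStarProjection he.1
  have hwfp := hw.mul_isStarProjection hf.1
  obtain ⟨y, hy, h1, h2⟩ := exists_comparison hwep hwfp
  by_cases hywe : y * (w * e) = 0
  swap
  · refine ⟨y * w, hy.mul hw, ?_, ?_, ?_⟩
    · rw [mul_assoc, hw.1.isIdempotentElem.eq]
    · rwa [mul_assoc]
    · rwa [mul_assoc, mul_assoc]
  -- In the remaining case comparability gives only `x f ≾ x e`, so `x e` contains infinitely many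
  -- copies of `x f` and decomposes into such copies over some central `z`.
  set x := (1 - y) * w with hx
  have hxc : IsCentralProjection x := hy.one_sub.mul hw
  have hxw : x * w = x := by rw [hx, mul_assoc, hw.1.isIdempotentElem.eq]
  have hxe : x * e = w * e := by rw [hx, mul_assoc, sub_mul, hywe, one_mul, sub_zero]
  have hxf0 : x * f ≠ 0 := fun h => hwe (by
    rw [← hxe, mul_eq_zero_of_centralCover_projLE hC hxc h])
  have hxfp := hxc.mul_isStarProjection hf.1
  have hxep := hxc.mul_isStarProjection he.1
  rw [← mul_assoc, ← mul_assoc, ← hx] at h2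
  obtain ⟨f', hfp, hff, hle⟩ := h2
  obtain ⟨I, p, hI, hp, -⟩ := exists_infinite_inGamma hf hf' (aleph0_lt_dim hf hf')
  obtain ⟨v, hv⟩ := hff.exists_implements hfp
  have hxp : IsOrthFamily (fun i => x * p i) := ⟨fun i => hxc.mul_isStarProjection (hp.1.1 i),
    fun i j h => by rw [hxc.mul_mul_mul, hp.1.2.1 i j h, mul_zero]⟩
  obtain ⟨h3, h4, h5⟩ := hv.famSup_conj hxp (by rw [hxc.famSup_mul, hp.1.famSup_eq])
  obtain ⟨z, hz, hzf, J, g, hJ, -, hg, hgf, hge, p', hp'⟩ :=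
    exists_central_decomposition hxep hxfp hxf0 h3 (fun i => (hv.restrict_le _).trans hle)
      fun i => (h5 i).symm.trans (hxp.1 i) ((hp.2 i).central_mul hf.1 hxc)
  have hzxf := hz.mul_isStarProjection hxfp
  have hzxe : z * (x * e) ≠ 0 := fun h => hzf
    (Subequivalent.eq_zero (Subequivalent.central_mul ⟨f', hfp, hff, hle⟩ hz) h)
  -- The same `J` indexes a family in `Γ(z x e)`, so `#J < d(e) ≤ d(f) = d(z x f)`.
  have hlt : #J < dim (z * (x * f)) := by
    have := lt_dim hzxe hp'
    rw [← mul_assoc] at this hzxe hzf ⊢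
    rw [he'.dim_central_mul (hz.mul hxc) hzxe] at this
    rw [hf'.dim_central_mul (hz.mul hxc) hzf]
    exact this.trans_le hd
  obtain ⟨K, k, hk, hJK⟩ := exists_inGamma_of_lt_dim hlt
  refine ⟨z * x, hz.mul hxc, by rw [mul_assoc, hxw], by rwa [mul_assoc], ?_⟩
  rw [mul_assoc z x e, mul_assoc z x f]
  exact (hge.subequivalent isStarProjection_famSup).trans
    (famSup_subequivalent_of_inGamma hg hzxf hgf hk hJK)

/-- Room for gluing: the two parts of another projection, each subequivalent to `f`, can be placed
orthogonally inside `f`. -/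
theorem exists_orthogonal_pair (hf : IsProperlyInfinite f) (hf' : IsEquidimensional f) :
    ∃ f₁ f₂ : A, IsStarProjection f₁ ∧ IsStarProjection f₂ ∧ f₁ * f₂ = 0 ∧ ProjLE f₁ f ∧
      ProjLE f₂ f ∧ Subequivalent f f₁ ∧ Subequivalent f f₂ := by
  obtain ⟨I, p, hI, hp, -⟩ := exists_infinite_inGamma hf hf' (aleph0_lt_dim hf hf')
  obtain ⟨i, j, hij⟩ := exists_pair_ne I
  exact ⟨p i, p j, hp.1.1 i, hp.1.1 j, hp.1.2.1 i j hij, hp.1.2.2.2.1 i, hp.1.2.2.2.1 j,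
    (hp.2 i).symm.subequivalent (hp.1.1 i), (hp.2 j).symm.subequivalent (hp.1.1 j)⟩

/-- Central gluing of subequivalences. -/
theorem subequivalent_of_central_cover (he : IsStarProjection e) (hf : IsProperlyInfinite f)
    (hf' : IsEquidimensional f) {S : Set A} (hS : ∀ s ∈ S, IsCentralProjection s)
    (horth : S.Pairwise fun s t => s * t = 0) (hSe : supProj S * e = e)
    (h : ∀ s ∈ S, Subequivalent (s * e) (s * f)) : Subequivalent e f := by
  obtain ⟨f₁, f₂, hf₁, hf₂, hf₁₂, hle₁, hle₂, hff₁, hff₂⟩ := exists_orthogonal_pair hf hf'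
  -- Infinite additivity requires source and target to be orthogonal. The part `e r ∼ f r` goes into
  -- `f₁` in one piece; the part `e (1 - r)` is orthogonal to `f`, so its central pieces can be
  -- glued into `f₂`.
  obtain ⟨r, hr, hre, hrf, hequiv, hrorth⟩ := exists_equivalent_cut he hf.1
  have hre' : (1 - r) * e = e * (1 - r) := by rw [sub_mul, mul_sub, hre, one_mul, mul_one]
  have hrf' : (1 - r) * f = f * (1 - r) := by rw [sub_mul, mul_sub, hrf, one_mul, mul_one]
  have hfr : IsStarProjection (f * r) := hf.1.mul hr hrf.symm
  have he' : IsStarProjection (e * (1 - r)) := he.mul hr.one_sub hre'.symm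
  have hfr_le : ProjLE (f * r) f := by
    rw [ProjLE, mul_assoc, hrf, ← mul_assoc, hf.1.isIdempotentElem.eq]
  have hle : ProjLE (e * (1 - r)) e := mul_one_sub_projLE he hre
  have he'f : e * (1 - r) * f = 0 := by rw [mul_assoc, hrf', hrorth]
  have hcS : ∀ s : S, IsCentralProjection s.1 := fun s => hS s s.2
  have hsub : ∀ s : S, Subequivalent (s * (e * (1 - r))) (s * f₂) := fun s =>
    (((hcS s).mul_projLE_mul hle).subequivalent ((hcS s).mul_isStarProjection he')).trans
      ((h s s.2).trans (hff₂.central_mul (hcS s)))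
  choose q hqp hpq hqle using hsub
  have hST : ∀ s t : S, s ≠ t → s.1 * t.1 = 0 := fun s t hst =>
    horth s.2 t.2 (Subtype.coe_ne_coe.mpr hst)
  have hmix : ∀ (s t : S) (a b : A), s ≠ t → s.1 * a * (t.1 * b) = 0 := fun s t a b hst => by
    rw [mul_assoc, ← mul_assoc a, ← (hcS t).2 a, mul_assoc, mul_mul_of_mul_eq (hST s t hst),
      zero_mul]
  have hpO : IsOrthFamily (fun s : S => s.1 * (e * (1 - r))) :=
    ⟨fun s => (hcS s).mul_isStarProjection he', fun s t hst => hmix s t _ _ hst⟩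
  have hqO : IsOrthFamily q := ⟨hqp, fun s t hst => by
    rw [← (hqle s).mul_eq, ← (hqle t).mul_eq_left (hqp t) ((hcS t).mul_isStarProjection hf₂),
      mul_assoc, ← mul_assoc (s.1 * f₂), hmix s t _ _ hst, zero_mul, mul_zero]⟩
  have hqf₂ : ∀ s, ProjLE (q s) f₂ := fun s => (hqle s).trans (mul_projLE _ hf₂)
  have hO : ∀ s t : S, s.1 * (e * (1 - r)) * q t = 0 := fun s t => by
    rw [← ((hqf₂ t).trans hle₂).mul_eq_left (hqp t) hf.1, mul_assoc, ← mul_assoc _ f, he'f,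
      zero_mul, mul_zero]
  have hsup : famSup (fun s : S => s.1 * (e * (1 - r))) = e * (1 - r) := by
    refine famSup_eq he' fun x => ⟨fun hx s => by rw [mul_assoc, hx, mul_zero], fun hx => ?_⟩
    have h1 : supProj S * (e * (1 - r) * x) = 0 := supProj_mul_eq_zero.mpr fun s hs => by
      rw [← mul_assoc]
      exact hx ⟨s, hs⟩
    rwa [mul_assoc, ← mul_assoc, hSe, ← mul_assoc] at h1
  have h1 : Subequivalent (e * (1 - r)) f₂ := by
    refine ⟨famSup q, isStarProjection_famSup, ?_, famSup_projLE hf₂ hqf₂⟩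
    have := famSup_equivalent hpO hqO hO hpq
    rwa [hsup] at this
  have h2 : Subequivalent (e * r) f₁ := (hequiv.subequivalent hfr).trans
    ((hfr_le.subequivalent hfr).trans hff₁)
  have h3 := h2.add hf₁ hf₂ h1 (mul_mul_one_sub_eq_zero hr hre) hf₁₂
  rw [add_mul_one_sub] at h3
  exact h3.trans ((projLE_add hle₁ hle₂).subequivalent (hf₁.add hf₂ hf₁₂))

/-- Exhaustion: if a maximal orthogonal family of central projections on which comparison holds did
not cover `e`, the local form applied to the uncovered part would enlarge it. -/
theorem subequivalent_of_dim_le (he : IsProperlyInfinite e) (he' : IsEquidimensional e)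
    (hf : IsProperlyInfinite f) (hf' : IsEquidimensional f)
    (hC : ProjLE (centralCover e) (centralCover f)) (hd : dim e ≤ dim f) :
    Subequivalent e f := by
  obtain ⟨S, -, hS, hR, hmax⟩ := exists_maximal_pairwise
    (fun z : A => IsCentralProjection z ∧ Subequivalent (z * e) (z * f))
    (fun z w => z * w = 0) ∅ (by simp) (by simp)
  have hT := isCentralProjection_supProj fun s hs => (hS s hs).1
  refine subequivalent_of_central_cover he.1 hf hf' (fun s hs => (hS s hs).1) hR ?_
    fun s hs => (hS s hs).2
  by_contra hne
  have hwe : (1 - supProj S) * e ≠ 0 := fun h => hne (by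
    rw [sub_mul, one_mul, sub_eq_zero] at h
    exact h.symm)
  obtain ⟨z, hz, hzw, hze, hsub⟩ :=
    exists_central_subequivalent he he' hf hf' hC hd hT.one_sub hwe
  have h1 : ∀ s ∈ S, s * z = 0 := supProj_mul_eq_zero.mp (by
    rw [← hzw, hz.2, ← mul_assoc, hT.1.mul_one_sub_self, zero_mul])
  have hmem : z ∈ S := hmax z ⟨hz, hsub⟩ fun s hs => ⟨by rw [hz.2, h1 s hs], h1 s hs⟩
  apply hze
  rw [← hz.1.isIdempotentElem.eq, h1 z hmem, zero_mul]

end Dimension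

end AWStar

theorem corollary5p4 {A : Type*} [CStarAlgebra A] [AWStarAlgebra A] (e f : A)
    (he : AWStar.IsProperlyInfinite e) (he' : AWStar.IsEquidimensional e)
    (hf : AWStar.IsProperlyInfinite f) (hf' : AWStar.IsEquidimensional f) :
    (AWStar.Subequivalent e f ↔
      AWStar.ProjLE (AWStar.centralCover e) (AWStar.centralCover f) ∧
        AWStar.dim e ≤ AWStar.dim f) ∧
    (AWStar.Equivalent e f ↔
      AWStar.centralCover e = AWStar.centralCover f ∧ AWStar.dim e = AWStar.dim f) := by
  have key : ∀ {e f : A}, AWStar.IsProperlyInfinite e → AWStar.IsEquidimensional e →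
      AWStar.IsProperlyInfinite f → AWStar.IsEquidimensional f →
      (AWStar.Subequivalent e f ↔
        AWStar.ProjLE (AWStar.centralCover e) (AWStar.centralCover f) ∧
          AWStar.dim e ≤ AWStar.dim f) := fun he he' hf hf' =>
    ⟨fun h => ⟨h.centralCover_projLE, h.dim_le he he' hf hf'⟩,
      fun h => AWStar.subequivalent_of_dim_le he he' hf hf' h.1 h.2⟩
  have hce := (AWStar.centralCover_spec e).1.1
  have hcf := (AWStar.centralCover_spec f).1.1
  refine ⟨key he he' hf hf', fun h => ?_, fun ⟨h1, h2⟩ => ?_⟩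
  · obtain ⟨h1, h2⟩ := (key he he' hf hf').mp (h.subequivalent hf.1)
    obtain ⟨h3, h4⟩ := (key hf hf' he he').mp (h.symm.subequivalent he.1)
    exact ⟨h1.antisymm hce hcf h3, h2.antisymm h4⟩
  · exact ((key he he' hf hf').mpr ⟨h1 ▸ .refl hce, h2.le⟩).antisymm he.1 hf.1
      ((key hf hf' he he').mpr ⟨h1 ▸ .refl hce, h2.ge⟩)
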